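/- **Setting.** Let $\Omega_{\mathbf x}\subset\mathbb R^3$ be open and bounded, $t_0<T$, and let $\Omega=\Omega_{\mathbf x}\times(t_0,T)\subset\mathbb R^4$ with coordinates $(x,y,z,t)$, the Euclidean metric and the orientation $dx\wedge dy\wedge dz\wedge dt$. Put $\Gamma_{\mathbf x}=\partial\Omega_{\mathbf x}\times(t_0,T)$, $\Gamma_{t_0}=\Omega_{\mathbf x}\times\{t_0\}$, $\Gamma_T=\Omega_{\mathbf x}\times\{T\}$. Let $\varepsilon>0$, and let $\alpha:\Omega_{\mathbf x}\to(0,\infty)$ and $\boldsymbol\beta:\Omega_{\mathbf x}\to\mathbb R^3$ be measurable with $\alpha$ and $\alpha^{-1}\boldsymbol\beta$ bounded. Let $$\mathbf b_1=\alpha^{-1}(\beta_1\,dx+\beta_2\,dy+\beta_3\,dz)-\varepsilon^{-1}dt ,$$ and assume that there is a bounded function $\psi_0$ on $\Omega$ with $d\psi_0=\mathbf b_1$ (weakly). Let $0\le k\le 4$. Let $L^2\Lambda^k(\Omega)$ be the space of real $k$-forms with coefficients in $L^2(\Omega)$, with $(\mathbf u,\mathbf v)_\Omega=\int_\Omega \mathbf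 u\wedge *\mathbf v$, and $H\Lambda^k(\Omega)=\{\mathbf v\in L^2\Lambda^k(\Omega): d\mathbf v\in L^2\Lambda^{k+1}(\Omega)\}$ with the weak exterior derivative $d$. Let $H\Lambda^k_D(\Omega)$ be the space of those $\mathbf v\in H\Lambda^k(\Omega)$ with $\mathbf n\wedge\mathbf v=0$ on $\Gamma_{\mathbf x}$ and on $\Gamma_{t_0}$ that have a (tangential) trace in $L^2$ on $\Gamma_T$; boundary conditions and traces are understood in the weak sense of Green's formula $(d\mathbf v,\boldsymbol\varphi)_\Omega-(\mathbf v,\delta\boldsymbol\varphi)_\Omega=\int_{\partial\Omega}\langle\mathbf n\wedge\mathbf v,\boldsymbol\varphi\rangle$, where for the condition on $\Gamma_{\mathbf x}\cup\Gamma_{t_0}$ one tests with all $\boldsymbol\varphi\in L^2$ with $\delta\boldsymbol\varphi\in L^2$ vanishing near $\Gamma_T$, and for the trace on $\Gamma_T$ with all smooth $\boldsymbol\varphi$ supported away from $\Gamma_{\mathbf x}\cup\Gamma_{t_0}$. Write $\langle\mathbf u,\mathbf v\rangle_{\Gamma_T}$ for the $L^2(\Gamma_T)$ inner product of the traces, and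 $$\|\mathbf v\|_{H\Lambda^k_D(\Omega)}^2=\|d\mathbf v\|_{L^2\Lambda^{k+1}(\Omega)}^2+\|\mathbf v\|_{L^2\Lambda^k(\Omega)}^2+\langle\mathbf v,\mathbf v\rangle_{\Gamma_T}.$$ Let $*$ be the Hodge star and $*_\alpha$ the scaled Hodge star, which sends a basis form $\boldsymbol\omega$ to $\alpha*\boldsymbol\omega$ if $\boldsymbol\omega$ does not involve $dt$ and to $\varepsilon*\boldsymbol\omega$ if it does. With the flux $\mathrm J_k\mathbf u=d\mathbf u+\mathbf b_1\wedge\mathbf u$, set $$\mathcal B(\mathbf u,\mathbf v)=(-1)^{(k+1)(4-(k+1))}(*\,*_\alpha\mathrm J_k\mathbf u,\,d\mathbf v)_\Omega+\langle\mathbf u,\mathbf v\rangle_{\Gamma_T}.$$ **Theorem (well-posedness).** Let $V$ be the space $H\Lambda^k_D(\Omega)$, or its subspace of forms whose components involving $dt$ vanish. Assume that $\mathcal B$ is continuous on $V$, that is, $|\mathcal B(\mathbf u,\mathbf v)|\le C_0\|\mathbf u\|_{H\Lambda^k_D(\Omega)}\|\mathbf v\|_{H\Lambda^k_D(\Omega)}$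 for all $\mathbf u,\mathbf v\in V$ and some constant $C_0$, and that it satisfies the inf-sup condition $$\inf_{0\ne\mathbf u\in V}\ \sup_{0\ne\mathbf v\in V}\frac{\mathcal B(\mathbf u,\mathbf v)}{\|\mathbf u\|_{H\Lambda^k_D(\Omega)}\|\mathbf v\|_{H\Lambda^k_D(\Omega)}}\ \ge\ c$$ for some $c>0$. Then there is a constant $C>0$ such that for every $\mathbf f_k\in L^2\Lambda^k(\Omega)$ there is exactly one $\mathbf u_k\in V$ with $$\mathcal B(\mathbf u_k,\mathbf v_k)=(\mathbf f_k,\mathbf v_k)_\Omega\qquad\text{for all }\mathbf v_k\in V,$$ and it satisfies $\|\mathbf u_k\|_{H\Lambda^k_D(\Omega)}\le C\|\mathbf f_k\|_{L^2\Lambda^k(\Omega)}$. -/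

import Mathlib

open MeasureTheory Set
open scoped ContDiff

noncomputable section

namespace SpaceTime

/-! ### Algebra of forms in the coordinates `(x, y, z, t) = (0, 1, 2, 3)` -/

/-- The space variable `(x, y, z)`. -/
abbrev Space := EuclideanSpace ℝ (Fin 3)

/-- The space-time variable `((x, y, z), t)`, with Lebesgue measure. -/
abbrev Point := Space × ℝ

/-- Constant-coefficient exterior forms on `ℝ⁴`: the entry at `I = {i₁ < … < i_m}` is the coefficient
of `dx^{i₁} ∧ … ∧ dx^{i_m}`. The basis forms are orthonormal. A `k`-form is an element whose
coefficients vanish at all `I` with `I.card ≠ k`. -/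
abbrev Form := EuclideanSpace ℝ (Finset (Fin 4))

/-- The sign of the permutation that sorts the elements of `I` (increasing) followed by those of `J`
(increasing), so that `dx^I ∧ dx^J = wedgeSign I J • dx^(I ∪ J)` for disjoint `I`, `J`. -/
def wedgeSign (I J : Finset (Fin 4)) : ℝ :=
  (-1) ^ ((I ×ˢ J).filter (fun p => p.2 < p.1)).card

/-- The wedge product. -/
def wedge (u v : Form) : Form :=
  WithLp.toLp 2 (fun J => ∑ I ∈ J.powerset, wedgeSign I (J \ I) * u I * v (J \ I))

/-- The basis 1-form `dx^j`; `dx 3` is `dt`. -/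
def dx (j : Fin 4) : Form := EuclideanSpace.single {j} 1

/-- The Euclidean Hodge star, `* dx^I = wedgeSign I Iᶜ • dx^(Iᶜ)`. -/
def hodgeStar (u : Form) : Form :=
  WithLp.toLp 2 (fun J => wedgeSign Jᶜ J * u Jᶜ)

/-- The scaled Hodge star: `* dx^I` is multiplied by `a` if `dx^I` does not involve `dt`, and by `ε`
if it does. -/
def hodgeStarScaled (a ε : ℝ) (u : Form) : Form :=
  WithLp.toLp 2 (fun J => (if (3 : Fin 4) ∈ Jᶜ then ε else a) * (wedgeSign Jᶜ J * u Jᶜ))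

/-- The coordinate directions of space-time. -/
def dir (j : Fin 4) : Point :=
  if h : j.val < 3 then (EuclideanSpace.single ⟨j.val, h⟩ 1, 0) else (0, 1)

/-! ### Classical differential operators and test forms -/

/-- The exterior derivative `∑ⱼ dx^j ∧ ∂ⱼ φ` of a differentiable form. -/
def dClassical (φ : Point → Form) (y : Point) : Form :=
  ∑ j : Fin 4, wedge (dx j) (fderiv ℝ φ y (dir j))

/-- The codifferential `- * d *` of a differentiable form, the formal adjoint of `d`. -/
def codiffClassical (φ : Point → Form) (y : Point) : Form :=
  - hodgeStar (dClassical (fun z => hodgeStar (φ z)) y)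

/-- Smooth forms with compact support in `U`. -/
def IsTestForm (U : Set Point) (φ : Point → Form) : Prop :=
  ContDiff ℝ ∞ φ ∧ HasCompactSupport φ ∧ tsupport φ ⊆ U

/-- `d v = w` in the weak sense on `U`. -/
def IsWeakD (U : Set Point) (v w : Point → Form) : Prop :=
  ∀ φ : Point → Form, IsTestForm U φ →
    ∫ y in U, inner ℝ (w y) (φ y) = ∫ y in U, inner ℝ (v y) (codiffClassical φ y)

/-- `δ v = w` in the weak sense on `U`. -/
def IsWeakCodiff (U : Set Point) (v w : Point → Form) : Prop :=
  ∀ φ : Point → Form, IsTestForm U φ →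
    ∫ y in U, inner ℝ (w y) (φ y) = ∫ y in U, inner ℝ (v y) (dClassical φ y)

/-! ### The space-time cylinder and the spaces of forms on it -/

/-- `Ω = Ω_x × (t₀, T)`. Its boundary is made of `Γ_x = ∂Ω_x × (t₀, T)`, `Γ_{t₀} = Ω_x × {t₀}` and
`Γ_T = Ω_x × {T}`. -/
def Omega (Ωx : Set Space) (t₀ T : ℝ) : Set Point := Ωx ×ˢ Ioo t₀ T

/-- Square-integrable forms (of mixed degree) on `Ω`. -/
abbrev L2Form (Ωx : Set Space) (t₀ T : ℝ) :=
  Lp Form 2 ((volume : Measure Point).restrict (Omega Ωx t₀ T))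

/-- Square-integrable forms (of mixed degree) on the terminal face `Γ_T`, which is identified
with `Ω_x`. -/
abbrev L2Terminal (Ωx : Set Space) :=
  Lp Form 2 ((volume : Measure Space).restrict Ωx)

section Spaces

variable (Ωx : Set Space) (t₀ T : ℝ)

/-- `L²Λ^k(Ω)`. -/
def L2Lambda (k : ℕ) : Set (L2Form Ωx t₀ T) :=
  {v | ∀ᵐ y ∂((volume : Measure Point).restrict (Omega Ωx t₀ T)),
    ∀ I : Finset (Fin 4), I.card ≠ k → v y I = 0}

/-- `HΛ^k(Ω)`: the forms in `L²Λ^k(Ω)` whose weak exterior derivative is in `L²Λ^{k+1}(Ω)`. -/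
def HLambda (k : ℕ) : Set (L2Form Ωx t₀ T) :=
  {v | v ∈ L2Lambda Ωx t₀ T k ∧
    ∃ w ∈ L2Lambda Ωx t₀ T (k + 1), IsWeakD (Omega Ωx t₀ T) v w}

variable {Ωx t₀ T}

/-- The weak exterior derivative `d v` (unique when it exists, which is the only case used). -/
def weakD (v : L2Form Ωx t₀ T) : L2Form Ωx t₀ T :=
  Classical.epsilon (fun w : L2Form Ωx t₀ T => IsWeakD (Omega Ωx t₀ T) v w)

/-- `n ∧ v = 0` on `Γ_D = Γ_x ∪ Γ_{t₀}`, in the weak sense: Green's formula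
`(d v, φ)_Ω - (v, δ φ)_Ω = ∫_{∂Ω} ⟨n ∧ v, φ⟩` has no boundary term for any form `φ ∈ L²` with
`δ φ ∈ L²` that vanishes in a neighbourhood of `Γ_T`. No regularity of `∂Ω_x` is needed. -/
def DirichletVanishes (v : L2Form Ωx t₀ T) : Prop :=
  ∀ φ ρ : L2Form Ωx t₀ T, IsWeakCodiff (Omega Ωx t₀ T) φ ρ →
    (∃ η > 0, ∀ᵐ y ∂((volume : Measure Point).restrict (Omega Ωx t₀ T)),
      T - η < y.2 → φ y = 0) →
    inner ℝ (weakD v) φ = inner ℝ v ρ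

/-- `g` is the trace of `v` on `Γ_T`, where the outward unit conormal is `n_T = dt`: `g` has no `dt`
component, and Green's formula holds with boundary term `∫_{Γ_T} ⟨n_T ∧ g, φ⟩` for smooth forms `φ`
supported away from `Γ_x` and `Γ_{t₀}`. (For `v` without `dt` components, `g` consists of the boundary
values of all components of `v`; in general it is the tangential part of `v`, the only part that has
boundary values for `v ∈ HΛ^k(Ω)`.) -/
def IsTerminalTrace (v : L2Form Ωx t₀ T) (g : L2Terminal Ωx) : Prop :=
  (∀ᵐ x ∂((volume : Measure Space).restrict Ωx),
    ∀ I : Finset (Fin 4), (3 : Fin 4) ∈ I → g x I = 0) ∧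
  ∀ φ : Point → Form, IsTestForm (Ωx ×ˢ Ioi t₀) φ →
    (∫ y in Omega Ωx t₀ T, inner ℝ (weakD v y) (φ y))
      - (∫ y in Omega Ωx t₀ T, inner ℝ (v y) (codiffClassical φ y))
      = ∫ x in Ωx, inner ℝ (wedge (dx 3) (g x)) (φ (x, T))

/-- The trace of `v` on `Γ_T` (unique when it exists, which is the only case used). -/
def terminalTrace (v : L2Form Ωx t₀ T) : L2Terminal Ωx :=
  Classical.epsilon (fun g : L2Terminal Ωx => IsTerminalTrace v g)

variable (Ωx t₀ T)

/-- `HΛ^k_D(Ω)`: the `v ∈ HΛ^k(Ω)` with `n ∧ v = 0` on `Γ_x` and `Γ_{t₀}`, and with a square-integrable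
trace on `Γ_T` (so that the norm of the space, which contains this trace, is finite). -/
def HLambdaD (k : ℕ) : Set (L2Form Ωx t₀ T) :=
  {v | v ∈ HLambda Ωx t₀ T k ∧ DirichletVanishes v ∧ ∃ g : L2Terminal Ωx, IsTerminalTrace v g}

/-- The `v ∈ HΛ^k_D(Ω)` whose components that involve `dt` vanish. -/
def HLambdaDSpatial (k : ℕ) : Set (L2Form Ωx t₀ T) :=
  {v | v ∈ HLambdaD Ωx t₀ T k ∧
    ∀ᵐ y ∂((volume : Measure Point).restrict (Omega Ωx t₀ T)),
      ∀ I : Finset (Fin 4), (3 : Fin 4) ∈ I → v y I = 0}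

variable {Ωx t₀ T}

/-- The norm of `HΛ^k_D(Ω)`. -/
def normHD (v : L2Form Ωx t₀ T) : ℝ :=
  Real.sqrt (‖weakD v‖ ^ 2 + ‖v‖ ^ 2 + ‖terminalTrace v‖ ^ 2)

end Spaces

/-! ### The convection-diffusion flux and the bilinear form -/

/-- A function as a 0-form. -/
def zeroForm (ψ : Point → ℝ) (y : Point) : Form := EuclideanSpace.single ∅ (ψ y)

/-- The convection 1-form `b₁ = α⁻¹ (β₁ dx + β₂ dy + β₃ dz) - ε⁻¹ dt`. -/
def convectionForm (α : Space → ℝ) (β : Space → Space) (ε : ℝ) (y : Point) : Form :=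
  (∑ i : Fin 3, ((α y.1)⁻¹ * β y.1 i) • dx i.castSucc) - ε⁻¹ • dx 3

/-- The flux `J u = d u + b₁ ∧ u`. -/
def flux {Ωx : Set Space} {t₀ T : ℝ} (α : Space → ℝ) (β : Space → Space) (ε : ℝ)
    (u : L2Form Ωx t₀ T) (y : Point) : Form :=
  weakD u y + wedge (convectionForm α β ε y) (u y)

/-- `𝓑(u, v) = (-1)^{(k+1)(4-(k+1))} (* *_α J u, d v)_Ω + ⟨u, v⟩_{Γ_T}`. -/
def bilin {Ωx : Set Space} {t₀ T : ℝ} (α : Space → ℝ) (β : Space → Space) (ε : ℝ) (k : ℕ)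
    (u v : L2Form Ωx t₀ T) : ℝ :=
  (-1 : ℝ) ^ (((k : ℤ) + 1) * (4 - ((k : ℤ) + 1))) *
      (∫ y in Omega Ωx t₀ T,
        inner ℝ (hodgeStar (hodgeStarScaled (α y.1) ε (flux α β ε u y))) (weakD v y))
    + inner ℝ (terminalTrace u) (terminalTrace v)

/-- Continuity of `B` on `V` for the norm of `HΛ^k_D(Ω)`. -/
def ContinuousOnSpace {Ωx : Set Space} {t₀ T : ℝ} (V : Set (L2Form Ωx t₀ T))
    (B : L2Form Ωx t₀ T → L2Form Ωx t₀ T → ℝ) : Prop :=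
  ∃ C > 0, ∀ u ∈ V, ∀ v ∈ V, |B u v| ≤ C * normHD u * normHD v

/-- The inf-sup condition for `B` on `V`: the infimum over `u ≠ 0` of the supremum over `v ≠ 0` of
`B(u, v) / (‖u‖ ‖v‖)` is at least some `c > 0`. Infimum and supremum are taken in `[-∞, ∞]`. -/
def InfSup {Ωx : Set Space} {t₀ T : ℝ} (V : Set (L2Form Ωx t₀ T))
    (B : L2Form Ωx t₀ T → L2Form Ωx t₀ T → ℝ) : Prop :=
  ∃ c : ℝ, 0 < c ∧
    (c : EReal) ≤ ⨅ u ∈ V \ {0}, ⨆ v ∈ V \ {0}, ((B u v / (normHD u * normHD v) : ℝ) : EReal)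

end SpaceTime

end

open SpaceTime

/-! The inf-sup condition bounds 𝓑 from below in its first argument. By the Banach–Nečas–Babuška
theorem (`exists_eq_of_infSup`, `exists_unique_of_infSup`) it remains to show nondegeneracy in the
second: if 𝓑(u, v) = 0 for all u ∈ V, then v = 0.

This comes from an exponential weight. If dψ = b₁ and m = exp(-ψ), then d(m v) = m dv - m b₁ ∧ v, so
J(m v) = m dv (`tripleFlux_mul`). The sign in front of 𝓑 cancels the sign of ** on (k+1)-forms, so
𝓑(m v, v) is the energy of dv with positive weights m α and m ε, plus the m-weighted square norm of
the terminal trace. Choosing u = m v therefore gives dv = 0 and zero trace (`eq_zero_of_energy`). No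
Poincaré inequality is needed to finish: m v now has zero flux and zero trace, so 𝓑(m v, ·) = 0, and
the inf-sup condition itself yields m v = 0 (`eq_zero_of_forall_bilin_eq_zero`).

The analytic work is to show m v ∈ V when the potential is merely bounded. A potential on the open
cylinder has no evident values on Γ_T, where the trace of m v has to be formed. The spatial
coefficients of b₁ do not depend on t, so averaging ψ₀ in time gives a bounded χ(x) with the same
spatial gradient (`exists_spatial_potential`), and ψ = χ - t/ε makes sense at t = T. Mollifying χ
(`exists_smooth_approx`) exhibits m as a limit of smooth functions, bounded on compact sets together
with their gradients. The product rules then pass to the limit in Green's formula and in the weak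
codifferential, hence also in the Dirichlet condition (`IsMultiplier.isGraphTriple`).

Completeness is obtained by replacing v with the triple (dv, v, tr v) in a Hilbert sum. The graph is
closed because all its conditions are linear and continuous in the triple
(`isClosedLinear_isGraphTriple`), and its norm is `normHD`. -/

noncomputable section

/-! ### Exterior algebra on ℝ⁴: adjoints and signs. -/

namespace SpaceTime

/-- The wedge product as a bilinear map. -/
def wedgeBilin : Form →ₗ[ℝ] Form →ₗ[ℝ] Form :=
  LinearMap.mk₂ ℝ wedge
    (fun u u' v => by
      ext J; simp only [wedge, PiLp.add_apply, ← Finset.sum_add_distrib]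
      exact Finset.sum_congr rfl fun I _ => by ring)
    (fun c u v => by
      ext J; simp only [wedge, PiLp.smul_apply, smul_eq_mul, Finset.mul_sum]
      exact Finset.sum_congr rfl fun I _ => by ring)
    (fun u v v' => by
      ext J; simp only [wedge, PiLp.add_apply, ← Finset.sum_add_distrib]
      exact Finset.sum_congr rfl fun I _ => by ring)
    (fun c u v => by
      ext J; simp only [wedge, PiLp.smul_apply, smul_eq_mul, Finset.mul_sum]
      exact Finset.sum_congr rfl fun I _ => by ring)

/-- Exterior multiplication by `dx^j`. -/
def extMul (j : Fin 4) : Form →L[ℝ] Form :=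
  LinearMap.toContinuousLinearMap (wedgeBilin (dx j))

theorem extMul_apply (j : Fin 4) (u : Form) : extMul j u = wedge (dx j) u := rfl

/-- The Hodge star as a continuous linear map. -/
def hodgeL : Form →L[ℝ] Form :=
  LinearMap.toContinuousLinearMap
    { toFun := hodgeStar
      map_add' := fun u v => by ext J; simp [hodgeStar, mul_add]
      map_smul' := fun c u => by ext J; simp [hodgeStar]; ring }

theorem hodgeL_apply (u : Form) : hodgeL u = hodgeStar u := rfl

theorem extMul_coeff (j : Fin 4) (u : Form) (J : Finset (Fin 4)) :
    extMul j u J = if j ∈ J then wedgeSign {j} (J \ {j}) * u (J \ {j}) else 0 := by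
  rw [extMul_apply]
  simp only [wedge, dx, PiLp.single_apply]
  split_ifs with h
  · rw [Finset.sum_eq_single {j}]
    · simp
    · intro I _ hI; simp [hI]
    · intro h'; simp [h] at h'
  · refine Finset.sum_eq_zero fun I hI => ?_
    rw [if_neg]
    · simp
    · rintro rfl
      simp [h] at hI

/-- Reduces sign identities to parities of natural numbers, which `decide` can check over all index
sets. -/
theorem neg_one_pow_mod_two (m n : ℕ) (h : m % 2 = n % 2) : (-1 : ℝ) ^ m = (-1) ^ n := by
  rw [neg_one_pow_eq_pow_mod_two, h, ← neg_one_pow_eq_pow_mod_two]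

/-- The signs in the formula for the adjoint of the exterior multiplication. -/
theorem wedgeSign_adjoint (j : Fin 4) (L : Finset (Fin 4)) (h : j ∉ L) :
    wedgeSign {j} L =
      wedgeSign Lᶜ L * (wedgeSign {j} (Lᶜ \ {j}) * wedgeSign (Lᶜ \ {j})ᶜ (Lᶜ \ {j})) := by
  simp only [wedgeSign, ← pow_add]
  apply neg_one_pow_mod_two
  revert j L
  decide

/-- This is the sign of ** on forms of degree `J.card`: interchanging the two blocks takes one
transposition for each pair of indices. -/
theorem wedgeSign_compl_mul (J : Finset (Fin 4)) :
    wedgeSign Jᶜ J * wedgeSign J Jᶜ = (-1) ^ (J.card * (4 - J.card)) := by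
  simp only [wedgeSign, ← pow_add]
  apply neg_one_pow_mod_two
  revert J
  decide

/-- In even dimension, contraction with dx^j is * (dx^j ∧ *) with no degree-dependent sign. The
proof pairs each index set containing j with the one obtained by erasing j; `wedgeSign_adjoint`
matches the signs. -/
theorem inner_extMul (j : Fin 4) (u w : Form) :
    inner ℝ (extMul j u) w = inner ℝ u (hodgeL (extMul j (hodgeL w))) := by
  simp only [PiLp.inner_apply, extMul_coeff, hodgeL_apply, hodgeStar, RCLike.inner_apply,
    conj_trivial]
  have e1 : ∀ f : Finset (Fin 4) → ℝ,
      ∑ J, (if j ∈ J then f J else 0) = ∑ L, (if j ∈ L then 0 else f (insert j L)) := by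
    intro f
    have e0 : ∀ L : Finset (Fin 4), (if j ∈ L then 0 else f (insert j L)) =
        if j ∉ L then f (insert j L) else 0 := fun L => by split_ifs <;> simp_all
    simp only [e0]
    rw [← Finset.sum_filter, ← Finset.sum_filter]
    refine Finset.sum_bij' (fun J _ => J.erase j) (fun L _ => insert j L) ?_ ?_ ?_ ?_ ?_
    all_goals simp +contextual
  have e2 := e1 fun J => w J * (wedgeSign {j} (J \ {j}) * u (J \ {j}))
  simp only [mul_ite, mul_zero] at *
  rw [e2]
  refine Finset.sum_congr rfl fun L _ => ?_
  by_cases h : j ∈ L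
  · simp [h]
  · have h2 : insert j L \ {j} = L := by
      ext x; simp only [Finset.mem_sdiff, Finset.mem_insert, Finset.mem_singleton]
      constructor
      · tauto
      · intro hx; exact ⟨Or.inr hx, fun e => h (e ▸ hx)⟩
    have h3 : (Lᶜ \ {j})ᶜ = insert j L := by ext x; simp; tauto
    have := wedgeSign_adjoint j L h
    rw [h3] at this
    simp only [h, if_false, h2, h3, Finset.mem_compl, not_false_eq_true, if_true, this]
    ring

theorem hodgeL_extMul_hodgeL (j : Fin 4) (w : Form) :
    hodgeL (extMul j (hodgeL w)) = ContinuousLinearMap.adjoint (extMul j) w := by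
  refine ext_inner_left ℝ fun u => ?_
  rw [← inner_extMul, ContinuousLinearMap.adjoint_inner_right]

/-- The projection of forms to the components satisfying `p`. -/
def compProj (p : Finset (Fin 4) → Prop) [DecidablePred p] : Form →L[ℝ] Form :=
  LinearMap.toContinuousLinearMap
    { toFun := fun u => WithLp.toLp 2 fun J => if p J then u J else 0
      map_add' := fun u v => by ext J; by_cases h : p J <;> simp [h]
      map_smul' := fun c u => by ext J; by_cases h : p J <;> simp [h] }

theorem compProj_apply (p : Finset (Fin 4) → Prop) [DecidablePred p] (u : Form)
    (J : Finset (Fin 4)) : compProj p u J = if p J then u J else 0 := rfl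

/-- Degree conditions and absence of dt become kernels of a continuous map, hence closed conditions
in L². -/
theorem compProj_eq_zero (p : Finset (Fin 4) → Prop) [DecidablePred p] (u : Form) :
    compProj p u = 0 ↔ ∀ J, p J → u J = 0 := by
  constructor
  · intro h J hJ
    have := congrArg (fun f : Form => f J) h
    simpa [compProj_apply, hJ] using this
  · intro h
    ext J
    by_cases hJ : p J <;> simp [compProj_apply, hJ, h]

/-- The star of the scaled star, which is diagonal. -/
theorem hodgeStar_hodgeStarScaled_coeff (a ε : ℝ) (w : Form) (J : Finset (Fin 4)) :
    hodgeStar (hodgeStarScaled a ε w) J =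
      (-1) ^ (J.card * (4 - J.card)) * ((if (3 : Fin 4) ∈ J then ε else a) * w J) := by
  rw [← wedgeSign_compl_mul]
  simp only [hodgeStar, hodgeStarScaled, compl_compl]
  ring

/-- `* *_α` is the sum of `α` and `ε` times constant operators. -/
theorem hodgeStar_hodgeStarScaled (a ε : ℝ) (w : Form) :
    hodgeStar (hodgeStarScaled a ε w) =
      a • hodgeStar (hodgeStarScaled 1 0 w) + ε • hodgeStar (hodgeStarScaled 0 1 w) := by
  ext J
  simp only [hodgeStar_hodgeStarScaled_coeff, PiLp.add_apply, PiLp.smul_apply, smul_eq_mul]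
  split_ifs <;> ring

/-- `* *_α` with constant coefficients as a continuous linear map. -/
def hodgeScaledL (a ε : ℝ) : Form →L[ℝ] Form :=
  LinearMap.toContinuousLinearMap
    { toFun := fun w => hodgeStar (hodgeStarScaled a ε w)
      map_add' := fun u v => by
        ext J; simp only [hodgeStar_hodgeStarScaled_coeff, PiLp.add_apply]; ring
      map_smul' := fun c u => by
        ext J
        simp only [hodgeStar_hodgeStarScaled_coeff, PiLp.smul_apply, smul_eq_mul, RingHom.id_apply]
        ring }

theorem hodgeScaledL_apply (a ε : ℝ) (w : Form) :
    hodgeScaledL a ε w = hodgeStar (hodgeStarScaled a ε w) := rfl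

theorem zpow_sign_mul_pow_sign (k : ℕ) (hk : k ≤ 4) (J : Finset (Fin 4)) (hJ : J.card = k + 1) :
    (-1 : ℝ) ^ (((k : ℤ) + 1) * (4 - ((k : ℤ) + 1))) * (-1) ^ (J.card * (4 - J.card)) = 1 := by
  have h4 : J.card ≤ 4 := by simpa using J.card_le_univ
  rw [hJ] at h4 ⊢
  -- A 5-form would be needed for k = 4, so the natural subtraction 4 - (k+1) never truncates.
  have hk3 : k ≤ 3 := by omega
  interval_cases k <;> norm_num

theorem sign_smul_hodgeStar_hodgeStarScaled_coeff (a ε : ℝ) (k : ℕ) (hk : k ≤ 4) (w : Form)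
    (hw : ∀ J : Finset (Fin 4), J.card ≠ k + 1 → w J = 0) (J : Finset (Fin 4)) :
    (-1 : ℝ) ^ (((k : ℤ) + 1) * (4 - ((k : ℤ) + 1))) * hodgeStar (hodgeStarScaled a ε w) J =
      (if (3 : Fin 4) ∈ J then ε else a) * w J := by
  rw [hodgeStar_hodgeStarScaled_coeff]
  by_cases hJ : J.card = k + 1
  · rw [← mul_assoc, zpow_sign_mul_pow_sign k hk J hJ, one_mul]
  · simp [hw J hJ]

/-- `(-1)^{(k+1)(4-(k+1))} * *_α` is positive definite on `(k+1)`-forms. -/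
theorem inner_hodgeStar_hodgeStarScaled (a ε : ℝ) (k : ℕ) (hk : k ≤ 4) (w : Form)
    (hw : ∀ J : Finset (Fin 4), J.card ≠ k + 1 → w J = 0) :
    min a ε * ‖w‖ ^ 2 ≤ (-1 : ℝ) ^ (((k : ℤ) + 1) * (4 - ((k : ℤ) + 1))) *
      inner ℝ (hodgeStar (hodgeStarScaled a ε w)) w := by
  rw [EuclideanSpace.real_norm_sq_eq, PiLp.inner_apply, Finset.mul_sum, Finset.mul_sum]
  refine Finset.sum_le_sum fun J _ => ?_
  have := sign_smul_hodgeStar_hodgeStarScaled_coeff a ε k hk w hw J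
  simp only [RCLike.inner_apply, conj_trivial]
  rw [mul_left_comm, this]
  have h2 : min a ε ≤ (if (3 : Fin 4) ∈ J then ε else a) := by
    split_ifs
    · exact min_le_right _ _
    · exact min_le_left _ _
  nlinarith [sq_nonneg (w J)]

theorem convectionForm_castSucc (α : Space → ℝ) (β : Space → Space) (ε : ℝ) (y : Point)
    (i : Fin 3) : convectionForm α β ε y {i.castSucc} = (α y.1)⁻¹ * β y.1 i := by
  fin_cases i <;> simp [convectionForm, Fin.sum_univ_succ, dx]

theorem convectionForm_three (α : Space → ℝ) (β : Space → Space) (ε : ℝ) (y : Point) :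
    convectionForm α β ε y {3} = - ε⁻¹ := by
  simp [convectionForm, Fin.sum_univ_succ, dx]

/-- Separates the rough scalar coefficients from the constant operators dx^j ∧, so that on L² the
convection term is a sum of bounded multiplications composed with constant maps. -/
theorem wedge_convectionForm (α : Space → ℝ) (β : Space → Space) (ε : ℝ) (y : Point) (u : Form) :
    wedge (convectionForm α β ε y) u =
      ∑ j : Fin 4, (convectionForm α β ε y {j}) • extMul j u := by
  have h1 : convectionForm α β ε y = ∑ j : Fin 4, (convectionForm α β ε y {j}) • dx j := by
    rw [Fin.sum_univ_castSucc]
    simp only [convectionForm_castSucc]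
    rw [show Fin.last 3 = (3 : Fin 4) from rfl, convectionForm_three, neg_smul, ← sub_eq_add_neg]
    rfl
  change wedgeBilin (convectionForm α β ε y) u = _
  conv_lhs => rw [h1]
  simp [extMul]

/-- Exterior multiplication by `dt` is injective on forms without `dt`. -/
theorem eq_zero_of_extMul_three (g : Form) (hg : ∀ I : Finset (Fin 4), (3 : Fin 4) ∈ I → g I = 0)
    (h : extMul 3 g = 0) : g = 0 := by
  ext I
  by_cases hI : (3 : Fin 4) ∈ I
  · simp [hg I hI]
  · have h1 := congrArg (fun f : Form => f (insert 3 I)) h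
    have h2 : insert 3 I \ {3} = I := by
      ext x; simp only [Finset.mem_sdiff, Finset.mem_insert, Finset.mem_singleton]
      constructor
      · tauto
      · intro hx; exact ⟨Or.inr hx, fun e => hI (e ▸ hx)⟩
    simp only [extMul_coeff, h2, Finset.mem_insert, true_or, if_true, PiLp.zero_apply] at h1
    simpa [wedgeSign] using h1

end SpaceTime

/-! ### Surjectivity from the inf-sup condition in a Hilbert space. -/

section Abstract

variable {H : Type*} [NormedAddCommGroup H] [InnerProductSpace ℝ H] [CompleteSpace H]

/-- The Banach–Nečas–Babuška theorem on a real Hilbert space. -/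
theorem exists_eq_of_infSup (B : H →L[ℝ] H →L[ℝ] ℝ) {c : ℝ} (hc : 0 < c)
    (hB : ∀ u, c * ‖u‖ ≤ ‖B u‖) (hB' : ∀ v, (∀ u, B u v = 0) → v = 0) (l : H →L[ℝ] ℝ) :
    ∃ u, B u = l := by
  let D := InnerProductSpace.toDual ℝ H
  let A : H →L[ℝ] H := InnerProductSpace.continuousLinearMapOfBilin B
  have hA : ∀ u v, inner ℝ (A u) v = B u v :=
    fun u v => InnerProductSpace.continuousLinearMapOfBilin_apply (𝕜 := ℝ) B u v
  have hDA : ∀ u, D (A u) = B u := fun u => by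
    ext v; simpa [D] using hA u v
  have hn : ∀ u, ‖A u‖ = ‖B u‖ := fun u => by rw [← hDA, LinearIsometryEquiv.norm_map]
  -- Bounded below, hence of closed range by completeness.
  have hanti : AntilipschitzWith (Real.toNNReal c⁻¹) A := by
    refine A.antilipschitz_of_bound fun u => ?_
    rw [Real.coe_toNNReal _ (inv_nonneg.2 hc.le), hn, inv_mul_eq_div, le_div_iff₀ hc, mul_comm]
    exact hB u
  have hcl : IsClosed (A.range : Set H) := by
    exact hanti.isClosed_range A.uniformContinuous
  have : CompleteSpace A.range := hcl.completeSpace_coe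
  -- A vector orthogonal to the range is annihilated by every `B u`, so `hB'` kills it; a closed
  -- range with trivial orthogonal complement is everything.
  have htop : A.range = ⊤ := by
    rw [← A.range.orthogonal_orthogonal, Submodule.eq_top_iff']
    intro w v hv
    rw [hB' v fun u => ?_, inner_zero_left]
    rw [← hA]
    exact hv _ ⟨u, rfl⟩
  obtain ⟨u, hu⟩ : D.symm l ∈ A.range := htop ▸ Submodule.mem_top
  refine ⟨u, ?_⟩
  rw [← hDA, show A u = D.symm l from hu, LinearIsometryEquiv.apply_symm_apply]

end Abstract

/-! ### Multiplication operators on L² and limits of pairings. -/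

section Multiplication

open scoped ENNReal

variable {X : Type*} [MeasurableSpace X] {μ : Measure X}
  {E : Type*} [NormedAddCommGroup E] [NormedSpace ℝ E]

/-- Multiplication by a bounded measurable function on `L²`. -/
theorem exists_mulLp (E : Type*) [NormedAddCommGroup E] [NormedSpace ℝ E]
    {a : X → ℝ} (ha : AEStronglyMeasurable a μ) {C : ℝ} (hC : ∀ᵐ x ∂μ, |a x| ≤ C) :
    ∃ A : Lp E 2 μ →L[ℝ] Lp E 2 μ, ∀ v, A v =ᵐ[μ] fun x => a x • v x := by
  have hm : MemLp a ∞ μ := memLp_top_of_bound ha C hC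
  refine ⟨(ContinuousLinearMap.lsmul ℝ ℝ).holderL μ ∞ 2 2 (hm.toLp a), fun v => ?_⟩
  refine ((ContinuousLinearMap.lsmul ℝ ℝ).coeFn_holder (hm.toLp a) v).trans ?_
  filter_upwards [hm.coeFn_toLp] with x hx
  simp [hx]

theorem compLpL_eq_zero_iff {F : Type*} [NormedAddCommGroup F] [NormedSpace ℝ F]
    (L : E →L[ℝ] F) (v : Lp E 2 μ) : L.compLpL 2 μ v = 0 ↔ ∀ᵐ x ∂μ, L (v x) = 0 := by
  rw [Lp.eq_zero_iff_ae_eq_zero]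
  exact ⟨fun h => by filter_upwards [h, L.coeFn_compLpL v] with x h1 h2; rw [← h2, h1]; rfl,
    fun h => by filter_upwards [h, L.coeFn_compLpL v] with x h1 h2; rw [h2, h1]; rfl⟩

theorem integral_inner_eq_inner_toLp {F : Type*} [NormedAddCommGroup F] [InnerProductSpace ℝ F]
    (w : Lp F 2 μ) {h : X → F} (hh : MemLp h 2 μ) :
    ∫ x, inner ℝ (w x) (h x) ∂μ = inner ℝ w (hh.toLp h) := by
  rw [L2.inner_def]
  refine integral_congr_ae ?_
  filter_upwards [hh.coeFn_toLp] with x hx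
  rw [hx]

theorem integrable_inner_Lp {F : Type*} [NormedAddCommGroup F] [InnerProductSpace ℝ F]
    (w : Lp F 2 μ) {h : X → F} (hh : MemLp h 2 μ) :
    Integrable (fun x => inner ℝ (w x) (h x)) μ := by
  refine (L2.integrable_inner (𝕜 := ℝ) w (hh.toLp h)).congr ?_
  filter_upwards [hh.coeFn_toLp] with x hx
  rw [hx]

/-- Passing to the limit in a pairing with scalar coefficients converging boundedly on the set where
the test field does not vanish. -/
theorem tendsto_integral_inner_smul {F : Type*} [NormedAddCommGroup F] [InnerProductSpace ℝ F]
    (w : Lp F 2 μ) {h : X → F} (hh : MemLp h 2 μ) {a : ℕ → X → ℝ} {b : X → ℝ}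
    (ha : ∀ n, AEStronglyMeasurable (a n) μ) {C : ℝ}
    (hC : ∀ n, ∀ᵐ x ∂μ, h x ≠ 0 → |a n x| ≤ C)
    (hlim : ∀ᵐ x ∂μ, h x ≠ 0 → Filter.Tendsto (fun n => a n x) Filter.atTop (nhds (b x))) :
    Filter.Tendsto (fun n => ∫ x, inner ℝ (w x) (a n x • h x) ∂μ) Filter.atTop
      (nhds (∫ x, inner ℝ (w x) (b x • h x) ∂μ)) := by
  have hi := integrable_inner_Lp w hh
  refine tendsto_integral_of_dominated_convergence (fun x => C * |inner ℝ (w x) (h x)|) ?_ ?_ ?_ ?_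
  · exact fun n => (Lp.aestronglyMeasurable w).inner ((ha n).smul hh.1)
  · exact hi.abs.const_mul C
  · intro n
    filter_upwards [hC n] with x hx
    rw [real_inner_smul_right, Real.norm_eq_abs, abs_mul]
    by_cases h0 : h x = 0
    · simp [h0]
    · exact mul_le_mul_of_nonneg_right (hx h0) (abs_nonneg _)
  · filter_upwards [hlim] with x hx
    by_cases h0 : h x = 0
    · simp [h0]
    · simp only [real_inner_smul_right]
      exact (hx h0).mul_const _

end Multiplication

/-! ### Smooth approximation of bounded functions with bounded weak derivatives. -/

section Mollification

open scoped Convolution Topology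
open Filter

variable {E : Type*} [NormedAddCommGroup E] [InnerProductSpace ℝ E] [FiniteDimensional ℝ E]
  [MeasurableSpace E] [BorelSpace E]

/-- The normalized bump is a probability density, so convolution with it is an average. -/
theorem abs_normed_convolution_le (φ : ContDiffBump (0 : E)) {f : E → ℝ} {M : ℝ}
    (hM : ∀ x, |f x| ≤ M) (x : E) :
    |(φ.normed volume ⋆[(ContinuousLinearMap.lsmul ℝ ℝ : ℝ →L[ℝ] ℝ →L[ℝ] ℝ), volume] f) x| ≤ M := by
  rw [convolution_def, ← Real.norm_eq_abs]
  calc _ ≤ ∫ t, φ.normed volume t * M := by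
        refine (norm_integral_le_of_norm_le (g := fun t => φ.normed volume t * M)
          (φ.integrable_normed.mul_const M) (Eventually.of_forall fun t => ?_))
        simp only [ContinuousLinearMap.lsmul_apply, smul_eq_mul, norm_mul, Real.norm_eq_abs]
        rw [abs_of_nonneg (φ.nonneg_normed t)]
        exact mul_le_mul_of_nonneg_left (hM _) (φ.nonneg_normed t)
    _ = M := by rw [integral_mul_const, φ.integral_normed, one_mul]

theorem locallyIntegrable_of_bound {f : E → ℝ} {M : ℝ} (hf : AEStronglyMeasurable f volume)
    (hM : ∀ x, |f x| ≤ M) : LocallyIntegrable f (volume : Measure E) :=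
  (memLp_top_of_bound hf M (Eventually.of_forall hM)).locallyIntegrable le_top

/-- A bounded function with bounded weak derivatives is the limit almost everywhere of smooth
functions, with convergence of the derivatives, boundedly on compact sets. -/
theorem exists_smooth_approx {ι : Type*} {U K : Set E} (hU : IsOpen U) (hK : IsCompact K)
    (hKU : K ⊆ U) {f : E → ℝ} {p : ι → E → ℝ} (e : ι → E)
    (hf : AEStronglyMeasurable f (volume.restrict U))
    (hp : ∀ i, AEStronglyMeasurable (p i) (volume.restrict U)) {M : ℝ}
    (hM0 : 0 ≤ M) (hfM : ∀ x ∈ U, |f x| ≤ M) (hpM : ∀ i, ∀ x ∈ U, |p i x| ≤ M)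
    (hder : ∀ i, ∀ η : E → ℝ, ContDiff ℝ ∞ η → HasCompactSupport η → tsupport η ⊆ U →
      ∫ x in U, p i x * η x = - ∫ x in U, f x * fderiv ℝ η x (e i)) :
    ∃ F : ℕ → E → ℝ, (∀ n, ContDiff ℝ ∞ (F n)) ∧ (∀ n x, |F n x| ≤ M) ∧
      (∀ᵐ x ∂(volume.restrict U), Tendsto (fun n => F n x) atTop (𝓝 (f x))) ∧
      (∀ n, ∀ x ∈ K, ∀ i, |fderiv ℝ (F n) x (e i)| ≤ M) ∧
      (∀ i, ∀ᵐ x ∂(volume.restrict U), x ∈ K →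
        Tendsto (fun n => fderiv ℝ (F n) x (e i)) atTop (𝓝 (p i x))) := by
  -- Balls of radius δ about points of K stay in U, so mollification at points of K never sees the
  -- extension by zero.
  obtain ⟨δ, hδ, hδU⟩ := hK.exists_cthickening_subset_open hU hKU
  have hmU := hU.measurableSet
  let φ : ℕ → ContDiffBump (0 : E) := fun n =>
    ⟨δ / (n + 1) / 2, δ / (n + 1), by positivity, half_lt_self (by positivity)⟩
  have hφ0 : Tendsto (fun n => (φ n).rOut) atTop (𝓝 0) := by
    have := (tendsto_one_div_add_atTop_nhds_zero_nat (𝕜 := ℝ)).const_mul δ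
    simpa only [φ, mul_one_div, mul_zero] using this
  -- Comparable inner and outer radii are what the almost everywhere convergence of mollifications
  -- of a locally integrable function requires.
  have hφ2 : ∀ᶠ n in atTop, (φ n).rOut ≤ 2 * (φ n).rIn :=
    Eventually.of_forall fun n => by simp only [φ]; linarith
  have hφδ : ∀ n, (φ n).rOut ≤ δ := fun n => by
    simp only [φ]
    exact div_le_self hδ.le (by linarith [n.cast_nonneg (α := ℝ)])
  have hbd : ∀ {g : E → ℝ}, (∀ x ∈ U, |g x| ≤ M) → ∀ x, |U.indicator g x| ≤ M := by
    intro g hg x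
    by_cases hx : x ∈ U
    · simpa [hx] using hg x hx
    · simpa [hx] using hM0
  have hloc : ∀ {g : E → ℝ}, AEStronglyMeasurable g (volume.restrict U) → (∀ x ∈ U, |g x| ≤ M) →
      LocallyIntegrable (U.indicator g) volume := fun hg hgM =>
    locallyIntegrable_of_bound ((aestronglyMeasurable_indicator_iff hmU).2 hg) (hbd hgM)
  let F : ℕ → E → ℝ := fun n =>
    (φ n).normed volume ⋆[ContinuousLinearMap.lsmul ℝ ℝ, volume] U.indicator f
  have hsm : ∀ n, ContDiff ℝ ∞ ((φ n).normed volume) := fun n => (φ n).contDiff_normed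
  have hcs : ∀ n, HasCompactSupport ((φ n).normed volume) := fun n =>
    (φ n).hasCompactSupport_normed
  have hFd : ∀ n, ∀ x ∈ K, ∀ i, fderiv ℝ (F n) x (e i) =
      ((φ n).normed volume ⋆[ContinuousLinearMap.lsmul ℝ ℝ, volume] U.indicator (p i)) x := by
    intro n x hx i
    rw [((hcs n).hasFDerivAt_convolution_left (ContinuousLinearMap.lsmul ℝ ℝ)
      ((hsm n).of_le (by exact_mod_cast le_top)) (hloc hf hfM) x).fderiv]
    rw [convolution_eq_swap, convolution_eq_swap]
    have hint : Integrable (fun t => ((ContinuousLinearMap.lsmul ℝ ℝ).precompL E)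
        (fderiv ℝ ((φ n).normed volume) (x - t)) (U.indicator f t)) volume := by
      have := ((hcs n).fderiv (𝕜 := ℝ)).convolutionExists_left
        ((ContinuousLinearMap.lsmul ℝ ℝ : ℝ →L[ℝ] ℝ →L[ℝ] ℝ).precompL E)
        ((hsm n).continuous_fderiv (by simp)) (hloc hf hfM) x
      exact this.integrable_swap
    rw [ContinuousLinearMap.integral_apply hint]
    -- The reflected kernel centred at x ∈ K is an admissible test function in U, so the weak
    -- derivative identity moves the derivative from the kernel to f.
    let η : E → ℝ := fun y => (φ n).normed volume (x - y)
    have hη : ContDiff ℝ ∞ η := (hsm n).comp (contDiff_const.sub contDiff_id)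
    have hηd : ∀ y, fderiv ℝ η y (e i) = - fderiv ℝ ((φ n).normed volume) (x - y) (e i) := by
      intro y
      have h1 : HasFDerivAt η ((fderiv ℝ ((φ n).normed volume) (x - y)).comp
          (-(ContinuousLinearMap.id ℝ E))) y := by
        have h2 := (((hsm n).differentiable (by simp)) (x - y)).hasFDerivAt
        exact h2.comp y ((hasFDerivAt_id y).const_sub x)
      rw [h1.fderiv]
      simp
    have hηs : tsupport η ⊆ Metric.closedBall x δ := by
      refine closure_minimal (fun y hy => ?_) Metric.isClosed_closedBall
      have : x - y ∈ Function.support ((φ n).normed volume) := hy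
      rw [(φ n).support_normed_eq, mem_ball_zero_iff] at this
      rw [mem_closedBall_iff_norm']
      exact this.le.trans (hφδ n)
    have hηc : HasCompactSupport η :=
      HasCompactSupport.of_support_subset_isCompact (isCompact_closedBall x δ)
        ((subset_tsupport η).trans hηs)
    have hηU : tsupport η ⊆ U :=
      hηs.trans ((Metric.closedBall_subset_cthickening hx δ).trans hδU)
    have key := hder i η hη hηc hηU
    have e1 : ∀ t, (ContinuousLinearMap.lsmul ℝ ℝ) ((φ n).normed volume (x - t))
        (U.indicator (p i) t) = U.indicator (fun t => p i t * η t) t := by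
      intro t
      by_cases ht : t ∈ U <;> simp [ht, η, mul_comm]
    have e2 : ∀ t, (((ContinuousLinearMap.lsmul ℝ ℝ).precompL E)
        (fderiv ℝ ((φ n).normed volume) (x - t)) (U.indicator f t)) (e i) =
        - U.indicator (fun t => f t * fderiv ℝ η t (e i)) t := by
      intro t
      by_cases ht : t ∈ U <;> simp [ht, hηd, ContinuousLinearMap.precompL_apply, mul_comm]
    simp only [e1, e2]
    rw [integral_neg, integral_indicator hmU, integral_indicator hmU, key]
  refine ⟨F, fun n => ?_, fun n x => abs_normed_convolution_le _ (hbd hfM) x, ?_, ?_, ?_⟩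
  · exact (hcs n).contDiff_convolution_left _ (hsm n) (hloc hf hfM)
  · rw [ae_restrict_iff' hmU]
    filter_upwards [ContDiffBump.ae_convolution_tendsto_right_of_locallyIntegrable hφ0 hφ2
      (hloc hf hfM)] with x hx hxU
    simpa [hxU] using hx
  · intro n x hx i
    rw [hFd n x hx i]
    exact abs_normed_convolution_le _ (hbd (hpM i)) x
  · intro i
    rw [ae_restrict_iff' hmU]
    filter_upwards [ContDiffBump.ae_convolution_tendsto_right_of_locallyIntegrable hφ0 hφ2
      (hloc (hp i) (hpM i))] with x hx hxU hxK
    simp only [hFd _ x hxK]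
    simpa [hxU] using hx

end Mollification

/-! ### Calculus of test forms. -/

namespace SpaceTime

section Tests

variable {U W : Set Point} {φ : Point → Form}

theorem dClassical_eq (φ : Point → Form) (y : Point) :
    dClassical φ y = ∑ j : Fin 4, extMul j (fderiv ℝ φ y (dir j)) := rfl

/-- Written without Hodge stars, the codifferential visibly satisfies a product rule and is minus
the sum of the adjoints of dx^j ∧ applied to partial derivatives. -/
theorem codiffClassical_eq {φ : Point → Form} (hφ : Differentiable ℝ φ) (y : Point) :
    codiffClassical φ y =
      - ∑ j : Fin 4, ContinuousLinearMap.adjoint (extMul j) (fderiv ℝ φ y (dir j)) := by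
  have h1 : fderiv ℝ (fun z => hodgeStar (φ z)) y = hodgeL.comp (fderiv ℝ φ y) :=
    (hodgeL.hasFDerivAt.comp y (hφ y).hasFDerivAt).fderiv
  rw [codiffClassical, dClassical, h1]
  change - hodgeL (∑ j : Fin 4, extMul j (hodgeL (fderiv ℝ φ y (dir j)))) = _
  simp only [map_sum, hodgeL_extMul_hodgeL]

theorem IsTestForm.mono (h : IsTestForm U φ) (hUW : U ⊆ W) : IsTestForm W φ :=
  ⟨h.1, h.2.1, h.2.2.trans hUW⟩

theorem IsTestForm.differentiable (h : IsTestForm U φ) : Differentiable ℝ φ :=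
  h.1.differentiable (by simp)

theorem IsTestForm.continuous_fderiv (h : IsTestForm U φ) (v : Point) :
    Continuous fun y => fderiv ℝ φ y v :=
  (h.1.continuous_fderiv (by simp)).clm_apply continuous_const

theorem IsTestForm.hasCompactSupport_fderiv (h : IsTestForm U φ) (v : Point) :
    HasCompactSupport fun y => fderiv ℝ φ y v :=
  h.2.1.fderiv_apply (𝕜 := ℝ) v

theorem IsTestForm.memLp (h : IsTestForm U φ) (μ : Measure Point) [IsLocallyFiniteMeasure μ] :
    MemLp φ 2 μ :=
  h.1.continuous.memLp_of_hasCompactSupport h.2.1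

theorem IsTestForm.memLp_clm_fderiv (h : IsTestForm U φ) (L : Form →L[ℝ] Form) (v : Point)
    (μ : Measure Point) [IsLocallyFiniteMeasure μ] :
    MemLp (fun y => L (fderiv ℝ φ y v)) 2 μ :=
  L.comp_memLp' ((h.continuous_fderiv v).memLp_of_hasCompactSupport (h.hasCompactSupport_fderiv v))

theorem IsTestForm.memLp_dClassical (h : IsTestForm U φ) (μ : Measure Point)
    [IsLocallyFiniteMeasure μ] : MemLp (dClassical φ) 2 μ := by
  have : dClassical φ = fun y => ∑ j : Fin 4, extMul j (fderiv ℝ φ y (dir j)) := rfl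
  rw [this]
  exact memLp_finsetSum _ fun j _ => h.memLp_clm_fderiv _ _ μ

theorem IsTestForm.memLp_codiffClassical (h : IsTestForm U φ) (μ : Measure Point)
    [IsLocallyFiniteMeasure μ] : MemLp (codiffClassical φ) 2 μ := by
  rw [funext (codiffClassical_eq h.differentiable)]
  exact (memLp_finsetSum _ fun j _ => h.memLp_clm_fderiv _ _ μ).neg

theorem IsTestForm.smul (h : IsTestForm U φ) {m : Point → ℝ} (hm : ContDiff ℝ ∞ m) :
    IsTestForm U fun y => m y • φ y := by
  refine ⟨hm.smul h.1, ?_, ?_⟩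
  · change HasCompactSupport (m • φ)
    exact h.2.1.smul_left
  · exact (tsupport_smul_subset_right m φ).trans h.2.2

theorem IsTestForm.fderiv_smul (h : IsTestForm U φ) {m : Point → ℝ} (hm : ContDiff ℝ ∞ m)
    (y v : Point) : fderiv ℝ (fun y => m y • φ y) y v =
      m y • fderiv ℝ φ y v + fderiv ℝ m y v • φ y := by
  rw [fderiv_fun_smul ((hm.differentiable (by simp)) y) (h.differentiable y)]
  simp

theorem IsTestForm.dClassical_smul (h : IsTestForm U φ) {m : Point → ℝ} (hm : ContDiff ℝ ∞ m)
    (y : Point) : dClassical (fun y => m y • φ y) y =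
      m y • dClassical φ y + ∑ j : Fin 4, fderiv ℝ m y (dir j) • extMul j (φ y) := by
  simp only [dClassical_eq, h.fderiv_smul hm, map_add, map_smul, Finset.sum_add_distrib,
    Finset.smul_sum]

theorem IsTestForm.codiffClassical_smul (h : IsTestForm U φ) {m : Point → ℝ}
    (hm : ContDiff ℝ ∞ m) (y : Point) : codiffClassical (fun y => m y • φ y) y =
      m y • codiffClassical φ y -
        ∑ j : Fin 4, fderiv ℝ m y (dir j) • ContinuousLinearMap.adjoint (extMul j) (φ y) := by
  rw [codiffClassical_eq (h.smul hm).differentiable, codiffClassical_eq h.differentiable]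
  simp only [h.fderiv_smul hm, map_add, map_smul, Finset.sum_add_distrib, Finset.smul_sum,
    smul_neg, neg_add, sub_eq_add_neg]

/-- The slice of a test form at a fixed time. -/
theorem IsTestForm.memLp_slice (h : IsTestForm U φ) (T : ℝ) (μ : Measure Space)
    [IsLocallyFiniteMeasure μ] : MemLp (fun x => φ (x, T)) 2 μ := by
  refine (h.1.continuous.comp (by fun_prop : Continuous fun x : Space => (x, T)))
    |>.memLp_of_hasCompactSupport ?_
  refine HasCompactSupport.of_support_subset_isCompact (h.2.1.isCompact.image continuous_fst) ?_
  intro x hx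
  exact ⟨(x, T), subset_tsupport _ hx, rfl⟩

/-- Products of test functions in space and time. -/
theorem isTestForm_prod {A : Set Space} {I : Set ℝ} {η : Space → ℝ} {θ : ℝ → ℝ}
    (hη : ContDiff ℝ ∞ η) (hηc : HasCompactSupport η) (hηA : tsupport η ⊆ A)
    (hθ : ContDiff ℝ ∞ θ) (hθc : HasCompactSupport θ) (hθI : tsupport θ ⊆ I) (c : Form) :
    IsTestForm (A ×ˢ I) fun y => (η y.1 * θ y.2) • c := by
  have hsub : Function.support (fun y : Point => (η y.1 * θ y.2) • c) ⊆
      tsupport η ×ˢ tsupport θ := by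
    intro y hy
    have hy' : (η y.1 * θ y.2) • c ≠ 0 := hy
    have h0 := left_ne_zero_of_smul hy'
    exact ⟨subset_tsupport _ (left_ne_zero_of_mul h0), subset_tsupport _ (right_ne_zero_of_mul h0)⟩
  refine ⟨by fun_prop, HasCompactSupport.of_support_subset_isCompact
    (hηc.isCompact.prod hθc.isCompact) hsub, ?_⟩
  exact (closure_minimal hsub ((isClosed_tsupport η).prod (isClosed_tsupport θ))).trans
    (prod_mono hηA hθI)

end Tests

/-! ### Uniqueness of the weak derivative and of the terminal trace. -/

section Uniqueness

/-- The fundamental lemma of the calculus of variations for square-integrable forms. -/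
theorem Lp_eq_zero_of_integral_mul_eq_zero {E : Type*} [NormedAddCommGroup E] [NormedSpace ℝ E]
    [FiniteDimensional ℝ E] [MeasurableSpace E] [BorelSpace E] {μ : Measure E}
    [IsLocallyFiniteMeasure μ] {U : Set E}
    (hU : IsOpen U) (w : Lp Form 2 (μ.restrict U))
    (h : ∀ η : E → ℝ, ContDiff ℝ ∞ η → HasCompactSupport η → tsupport η ⊆ U →
      ∀ I : Finset (Fin 4), ∫ x in U, η x * w x I ∂μ = 0) : w = 0 := by
  rw [Lp.eq_zero_iff_ae_eq_zero]
  have h1 : ∀ I : Finset (Fin 4), ∀ᵐ x ∂(μ.restrict U), w x I = 0 := by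
    intro I
    have hI : MemLp (fun x => w x I) 2 (μ.restrict U) :=
      (EuclideanSpace.proj (𝕜 := ℝ) I : Form →L[ℝ] ℝ).comp_memLp' (Lp.memLp w)
    rw [ae_restrict_iff' hU.measurableSet]
    refine hU.ae_eq_zero_of_integral_contDiff_smul_eq_zero
      (locallyIntegrableOn_of_locallyIntegrable_restrict (hI.locallyIntegrable one_le_two)) ?_
    intro η hη hηc hηU
    rw [← h η hη hηc hηU I, setIntegral_eq_integral_of_forall_compl_eq_zero]
    · rfl
    · intro x hx
      rw [image_eq_zero_of_notMem_tsupport fun hx' => hx (hηU hx'), zero_mul]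
  filter_upwards [ae_all_iff.2 h1] with x hx
  ext I
  exact hx I

theorem inner_smul_single (u : Form) (a : ℝ) (I : Finset (Fin 4)) :
    inner ℝ u (a • (EuclideanSpace.single I 1 : Form)) = a * u I := by
  rw [real_inner_smul_right, EuclideanSpace.inner_single_right]
  simp

variable {Ωx : Set Space} {t₀ T : ℝ}

theorem isOpen_Omega (hΩo : IsOpen Ωx) : IsOpen (Omega Ωx t₀ T) := hΩo.prod isOpen_Ioo

/-- Testing with a scalar bump times a basis form isolates one coefficient, and the fundamental
lemma applies. This is what makes the choice in `weakD` harmless. -/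
theorem IsWeakD.unique (hΩo : IsOpen Ωx) {v w w' : L2Form Ωx t₀ T}
    (h : IsWeakD (Omega Ωx t₀ T) v w) (h' : IsWeakD (Omega Ωx t₀ T) v w') : w = w' := by
  rw [← sub_eq_zero]
  refine Lp_eq_zero_of_integral_mul_eq_zero (isOpen_Omega hΩo) _ fun η hη hηc hηU I => ?_
  have ht : IsTestForm (Omega Ωx t₀ T)
      (fun y => η y • (EuclideanSpace.single I 1 : Form)) :=
    ⟨hη.smul contDiff_const, hηc.smul_right, (tsupport_smul_subset_left η _).trans hηU⟩
  have e : ∫ y in Omega Ωx t₀ T, inner ℝ ((w - w') y) (η y • (EuclideanSpace.single I 1 : Form))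
      = 0 := by
    have h1 := (h _ ht).trans (h' _ ht).symm
    rw [integral_inner_eq_inner_toLp _ (ht.memLp _)] at h1 ⊢
    rw [integral_inner_eq_inner_toLp _ (ht.memLp _)] at h1
    rw [inner_sub_left, h1, sub_self]
  simpa only [inner_smul_single] using e

theorem weakD_eq (hΩo : IsOpen Ωx) {v w : L2Form Ωx t₀ T}
    (h : IsWeakD (Omega Ωx t₀ T) v w) : weakD v = w :=
  IsWeakD.unique hΩo (Classical.epsilon_spec (p := fun w : L2Form Ωx t₀ T =>
    IsWeakD (Omega Ωx t₀ T) v w) ⟨w, h⟩) h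

/-- The extension to `L²` of exterior multiplication by `dt` on traces. -/
def extT (Ωx : Set Space) : L2Terminal Ωx →L[ℝ] L2Terminal Ωx :=
  (extMul 3).compLpL 2 (volume.restrict Ωx)

theorem integral_extMul_slice (g : L2Terminal Ωx) {h : Space → Form}
    (hh : MemLp h 2 (volume.restrict Ωx)) :
    ∫ x in Ωx, inner ℝ (wedge (dx 3) (g x)) (h x) = inner ℝ (extT Ωx g) (hh.toLp h) := by
  rw [← integral_inner_eq_inner_toLp]
  refine integral_congr_ae ?_
  filter_upwards [(extMul 3).coeFn_compLpL (p := 2) g] with x hx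
  change _ = inner ℝ (((extMul 3).compLpL 2 (volume.restrict Ωx) g) x) _
  rw [hx]
  rfl

/-- Product test forms η(x) θ(t) with θ(T) = 1 determine dt ∧ g; since g has no dt component, this
determines g. -/
theorem IsTerminalTrace.unique (hΩo : IsOpen Ωx) (hT : t₀ < T) {v : L2Form Ωx t₀ T}
    {g g' : L2Terminal Ωx} (h : IsTerminalTrace v g) (h' : IsTerminalTrace v g') : g = g' := by
  have key : extT Ωx (g - g') = 0 := by
    refine Lp_eq_zero_of_integral_mul_eq_zero hΩo _ fun η hη hηc hηU I => ?_
    -- The outer radius stays below T - t₀, so the support avoids the initial face while crossing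
    -- the terminal one.
    let θ : ContDiffBump T :=
      ⟨(T - t₀) / 3, (T - t₀) / 2, by linarith, by linarith⟩
    have hθ : tsupport θ ⊆ Ioi t₀ := by
      rw [θ.tsupport_eq, Real.closedBall_eq_Icc]
      intro s hs
      simp only [θ, mem_Icc, mem_Ioi] at hs ⊢
      linarith
    have ht : IsTestForm (Ωx ×ˢ Ioi t₀)
        (fun y => (η y.1 * θ y.2) • (EuclideanSpace.single I 1 : Form)) :=
      isTestForm_prod hη hηc hηU θ.contDiff θ.hasCompactSupport hθ _
    have h1 := (h.2 _ ht).symm.trans (h'.2 _ ht)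
    have hθT : θ T = 1 := θ.one_of_mem_closedBall (by simp [θ.rIn_pos.le])
    have hs := ht.memLp_slice T (volume.restrict Ωx)
    rw [integral_extMul_slice _ hs, integral_extMul_slice _ hs, ← sub_eq_zero, ← inner_sub_left,
      ← map_sub, ← integral_inner_eq_inner_toLp] at h1
    simpa only [inner_smul_single, hθT, mul_one] using h1
  rw [← sub_eq_zero, Lp.eq_zero_iff_ae_eq_zero]
  filter_upwards [(compLpL_eq_zero_iff _ _).1 key, h.1, h'.1, Lp.coeFn_sub g g']
    with x hx hg hg' hs
  refine eq_zero_of_extMul_three _ (fun I hI => ?_) hx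
  rw [hs]
  simp [hg I hI, hg' I hI]

theorem terminalTrace_eq (hΩo : IsOpen Ωx) (hT : t₀ < T) {v : L2Form Ωx t₀ T} {g : L2Terminal Ωx}
    (h : IsTerminalTrace v g) : terminalTrace v = g :=
  IsTerminalTrace.unique hΩo hT (Classical.epsilon_spec (p := fun g : L2Terminal Ωx =>
    IsTerminalTrace v g) ⟨g, h⟩) h

end Uniqueness

/-! ### The graph space of triples (dv, v, tr v) and its closedness. -/

section Graph

variable (Ωx : Set Space) (t₀ T : ℝ)

/-- The Hilbert space of triples `(d v, v, tr v)`. -/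
abbrev Triple := WithLp 2 (L2Form Ωx t₀ T × WithLp 2 (L2Form Ωx t₀ T × L2Terminal Ωx))

variable {Ωx t₀ T}

/-- The derivative component of a triple. -/
def dPart : Triple Ωx t₀ T →L[ℝ] L2Form Ωx t₀ T := WithLp.fstL 2 ℝ _ _

/-- The form component of a triple. -/
def vPart : Triple Ωx t₀ T →L[ℝ] L2Form Ωx t₀ T :=
  (WithLp.fstL 2 ℝ _ _).comp (WithLp.sndL 2 ℝ (L2Form Ωx t₀ T) _)

/-- The trace component of a triple. -/
def gPart : Triple Ωx t₀ T →L[ℝ] L2Terminal Ωx :=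
  (WithLp.sndL 2 ℝ _ _).comp (WithLp.sndL 2 ℝ (L2Form Ωx t₀ T) _)

theorem Triple.norm_sq (h : Triple Ωx t₀ T) :
    ‖h‖ ^ 2 = ‖dPart h‖ ^ 2 + ‖vPart h‖ ^ 2 + ‖gPart h‖ ^ 2 := by
  rw [WithLp.prod_norm_sq_eq_of_L2, WithLp.prod_norm_sq_eq_of_L2, add_assoc]
  rfl

/-- The triple with given components. -/
def mkTriple (w v : L2Form Ωx t₀ T) (g : L2Terminal Ωx) : Triple Ωx t₀ T :=
  WithLp.toLp 2 (w, WithLp.toLp 2 (v, g))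

@[simp] theorem dPart_mkTriple (w v : L2Form Ωx t₀ T) (g : L2Terminal Ωx) :
    dPart (mkTriple w v g) = w := rfl

@[simp] theorem vPart_mkTriple (w v : L2Form Ωx t₀ T) (g : L2Terminal Ωx) :
    vPart (mkTriple w v g) = v := rfl

@[simp] theorem gPart_mkTriple (w v : L2Form Ωx t₀ T) (g : L2Terminal Ωx) :
    gPart (mkTriple w v g) = g := rfl

/-- `h = (d v, v, tr v)` for some `v ∈ HΛ^k_D(Ω)`, without components involving `dt` if
`spatial` holds. -/
structure IsGraphTriple (k : ℕ) (spatial : Prop) (h : Triple Ωx t₀ T) : Prop where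
  deg : vPart h ∈ L2Lambda Ωx t₀ T k
  degD : dPart h ∈ L2Lambda Ωx t₀ T (k + 1)
  green : ∀ φ : Point → Form, IsTestForm (Ωx ×ˢ Ioi t₀) φ →
    (∫ y in Omega Ωx t₀ T, inner ℝ (dPart h y) (φ y))
      - (∫ y in Omega Ωx t₀ T, inner ℝ (vPart h y) (codiffClassical φ y))
      = ∫ x in Ωx, inner ℝ (wedge (dx 3) (gPart h x)) (φ (x, T))
  trace : ∀ᵐ x ∂((volume : Measure Space).restrict Ωx),
    ∀ I : Finset (Fin 4), (3 : Fin 4) ∈ I → gPart h x I = 0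
  dirichlet : ∀ φ ρ : L2Form Ωx t₀ T, IsWeakCodiff (Omega Ωx t₀ T) φ ρ →
    (∃ η > 0, ∀ᵐ y ∂((volume : Measure Point).restrict (Omega Ωx t₀ T)),
      T - η < y.2 → φ y = 0) →
    inner ℝ (dPart h) φ = inner ℝ (vPart h) ρ
  noTime : spatial → ∀ᵐ y ∂((volume : Measure Point).restrict (Omega Ωx t₀ T)),
      ∀ I : Finset (Fin 4), (3 : Fin 4) ∈ I → vPart h y I = 0

/-- A test form supported in the open cylinder vanishes at t = T, so the terminal term of Green's
formula drops out. -/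
theorem IsGraphTriple.isWeakD {k : ℕ} {spatial : Prop} {h : Triple Ωx t₀ T}
    (hh : IsGraphTriple k spatial h) : IsWeakD (Omega Ωx t₀ T) (vPart h) (dPart h) := by
  intro φ hφ
  have h1 := hh.green φ (hφ.mono (prod_mono subset_rfl Ioo_subset_Ioi_self))
  rw [← sub_eq_zero, h1]
  have h0 : ∀ x : Space, φ (x, T) = 0 := fun x =>
    image_eq_zero_of_notMem_tsupport fun hx => lt_irrefl T (hφ.2.2 hx).2.2
  simp [h0]

theorem IsGraphTriple.weakD_eq (hΩo : IsOpen Ωx) {k : ℕ} {spatial : Prop} {h : Triple Ωx t₀ T}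
    (hh : IsGraphTriple k spatial h) : weakD (vPart h) = dPart h :=
  SpaceTime.weakD_eq hΩo hh.isWeakD

theorem IsGraphTriple.isTerminalTrace (hΩo : IsOpen Ωx) {k : ℕ} {spatial : Prop}
    {h : Triple Ωx t₀ T} (hh : IsGraphTriple k spatial h) :
    IsTerminalTrace (vPart h) (gPart h) := by
  refine ⟨hh.trace, ?_⟩
  rw [hh.weakD_eq hΩo]
  exact hh.green

theorem IsGraphTriple.terminalTrace_eq (hΩo : IsOpen Ωx) (hT : t₀ < T) {k : ℕ} {spatial : Prop}
    {h : Triple Ωx t₀ T} (hh : IsGraphTriple k spatial h) : terminalTrace (vPart h) = gPart h :=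
  SpaceTime.terminalTrace_eq hΩo hT (hh.isTerminalTrace hΩo)

theorem IsGraphTriple.normHD_eq (hΩo : IsOpen Ωx) (hT : t₀ < T) {k : ℕ} {spatial : Prop}
    {h : Triple Ωx t₀ T} (hh : IsGraphTriple k spatial h) : normHD (vPart h) = ‖h‖ := by
  rw [normHD, hh.weakD_eq hΩo, hh.terminalTrace_eq hΩo hT, ← Triple.norm_sq,
    Real.sqrt_sq (norm_nonneg _)]

/-- The derivative and the trace are determined by v, so the graph embeds into the space of forms;
uniqueness of solutions transfers through this. -/
theorem IsGraphTriple.ext (hΩo : IsOpen Ωx) (hT : t₀ < T) {k : ℕ} {spatial : Prop}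
    {h h' : Triple Ωx t₀ T} (hh : IsGraphTriple k spatial h) (hh' : IsGraphTriple k spatial h')
    (e : vPart h = vPart h') : h = h' := by
  have e1 : dPart h = dPart h' := by rw [← hh.weakD_eq hΩo, ← hh'.weakD_eq hΩo, e]
  have e2 : gPart h = gPart h' := by
    rw [← hh.terminalTrace_eq hΩo hT, ← hh'.terminalTrace_eq hΩo hT, e]
  have : mkTriple (dPart h) (vPart h) (gPart h) = mkTriple (dPart h') (vPart h') (gPart h') := by
    rw [e, e1, e2]
  exact this

/-- The space `HΛ^k_D(Ω)`, or its subspace of forms without `dt`. -/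
def HLambdaDSet (Ωx : Set Space) (t₀ T : ℝ) (k : ℕ) (spatial : Prop) : Set (L2Form Ωx t₀ T) :=
  {v | v ∈ HLambdaD Ωx t₀ T k ∧
    (spatial → ∀ᵐ y ∂((volume : Measure Point).restrict (Omega Ωx t₀ T)),
      ∀ I : Finset (Fin 4), (3 : Fin 4) ∈ I → v y I = 0)}

theorem IsGraphTriple.mem (hΩo : IsOpen Ωx) {k : ℕ} {spatial : Prop}
    {h : Triple Ωx t₀ T} (hh : IsGraphTriple k spatial h) :
    vPart h ∈ HLambdaDSet Ωx t₀ T k spatial := by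
  refine ⟨⟨⟨hh.deg, dPart h, hh.degD, hh.isWeakD⟩, ?_, gPart h, hh.isTerminalTrace hΩo⟩, hh.noTime⟩
  intro φ ρ h1 h2
  rw [hh.weakD_eq hΩo]
  exact hh.dirichlet φ ρ h1 h2

theorem exists_isGraphTriple (hΩo : IsOpen Ωx) (k : ℕ) (spatial : Prop)
    {v : L2Form Ωx t₀ T} (hv : v ∈ HLambdaDSet Ωx t₀ T k spatial) :
    ∃ h : Triple Ωx t₀ T, IsGraphTriple k spatial h ∧ vPart h = v := by
  obtain ⟨⟨⟨hdeg, w, hw, hwd⟩, hD, g, hg⟩, hs⟩ := hv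
  have e := weakD_eq hΩo hwd
  refine ⟨mkTriple w v g, ⟨hdeg, hw, ?_, hg.1, ?_, hs⟩, rfl⟩
  · have := hg.2
    rw [e] at this
    exact this
  · intro φ ρ h1 h2
    have := hD φ ρ h1 h2
    rw [e] at this
    exact this

/-- Predicates that cut out a closed subspace. -/
def IsClosedLinear {H : Type*} [NormedAddCommGroup H] [NormedSpace ℝ H] (p : H → Prop) : Prop :=
  ∃ S : Submodule ℝ H, IsClosed (S : Set H) ∧ ∀ h, h ∈ S ↔ p h

section ClosedLinear

variable {H F : Type*} [NormedAddCommGroup H] [NormedSpace ℝ H] [NormedAddCommGroup F]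
  [NormedSpace ℝ F]

theorem isClosedLinear_eq_zero (L : H →L[ℝ] F) : IsClosedLinear fun h => L h = 0 :=
  ⟨L.ker, L.isClosed_ker, fun _ => Iff.rfl⟩

theorem IsClosedLinear.forall {ι : Sort*} {p : ι → H → Prop} (hp : ∀ i, IsClosedLinear (p i)) :
    IsClosedLinear fun h => ∀ i, p i h := by
  choose S hS hSp using hp
  refine ⟨⨅ i, S i, ?_, fun h => ?_⟩
  · rw [Submodule.coe_iInf]
    exact isClosed_iInter hS
  · simp only [Submodule.mem_iInf, hSp]

theorem IsClosedLinear.and {p q : H → Prop} (hp : IsClosedLinear p) (hq : IsClosedLinear q) :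
    IsClosedLinear fun h => p h ∧ q h := by
  obtain ⟨S, hS, hSp⟩ := hp
  obtain ⟨S', hS', hSp'⟩ := hq
  exact ⟨S ⊓ S', hS.inter hS', fun h => by rw [Submodule.mem_inf, hSp, hSp']⟩

theorem IsClosedLinear.congr {p q : H → Prop} (hp : IsClosedLinear p) (h : ∀ x, q x ↔ p x) :
    IsClosedLinear q := by
  rwa [funext fun x => propext (h x)]

theorem isClosedLinear_inner_sub_inner {F₁ F₂ F₃ : Type*} [NormedAddCommGroup F₁]
    [InnerProductSpace ℝ F₁] [NormedAddCommGroup F₂] [InnerProductSpace ℝ F₂]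
    [NormedAddCommGroup F₃] [InnerProductSpace ℝ F₃] (L₁ : H →L[ℝ] F₁) (L₂ : H →L[ℝ] F₂)
    (L₃ : H →L[ℝ] F₃) (a₁ : F₁) (a₂ : F₂) (a₃ : F₃) :
    IsClosedLinear fun h => inner ℝ (L₁ h) a₁ - inner ℝ (L₂ h) a₂ = inner ℝ (L₃ h) a₃ := by
  refine (isClosedLinear_eq_zero ((innerSL ℝ a₁).comp L₁ - (innerSL ℝ a₂).comp L₂
    - (innerSL ℝ a₃).comp L₃)).congr fun h => ?_
  rw [← sub_eq_zero]
  simp [real_inner_comm]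

end ClosedLinear

theorem isClosedLinear_ae {H X : Type*} [NormedAddCommGroup H] [NormedSpace ℝ H]
    [MeasurableSpace X] {μ : Measure X} (L : H →L[ℝ] Lp Form 2 μ) (p : Finset (Fin 4) → Prop) :
    IsClosedLinear fun h => ∀ᵐ x ∂μ, ∀ I, p I → L h x I = 0 := by
  classical
  refine (isClosedLinear_eq_zero (((compProj p).compLpL 2 μ).comp L)).congr fun h => ?_
  rw [ContinuousLinearMap.comp_apply, compLpL_eq_zero_iff]
  simp only [compProj_eq_zero]

theorem isClosedLinear_green :
    IsClosedLinear fun h : Triple Ωx t₀ T =>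
    ∀ φ : Point → Form, IsTestForm (Ωx ×ˢ Ioi t₀) φ →
    (∫ y in Omega Ωx t₀ T, inner ℝ (dPart h y) (φ y))
      - (∫ y in Omega Ωx t₀ T, inner ℝ (vPart h y) (codiffClassical φ y))
      = ∫ x in Ωx, inner ℝ (wedge (dx 3) (gPart h x)) (φ (x, T)) := by
  refine IsClosedLinear.forall fun φ => IsClosedLinear.forall fun hφ => ?_
  have m1 := hφ.memLp ((volume : Measure Point).restrict (Omega Ωx t₀ T))
  have m2 := hφ.memLp_codiffClassical ((volume : Measure Point).restrict (Omega Ωx t₀ T))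
  have m3 := hφ.memLp_slice T ((volume : Measure Space).restrict Ωx)
  refine (isClosedLinear_inner_sub_inner dPart vPart ((extT Ωx).comp gPart) (m1.toLp φ)
    (m2.toLp _) (m3.toLp _)).congr fun h => ?_
  rw [integral_inner_eq_inner_toLp _ m1, integral_inner_eq_inner_toLp _ m2,
    integral_extMul_slice _ m3]
  rfl

theorem isClosedLinear_dirichlet :
    IsClosedLinear fun h : Triple Ωx t₀ T => ∀ φ ρ : L2Form Ωx t₀ T,
    IsWeakCodiff (Omega Ωx t₀ T) φ ρ →
    (∃ η > 0, ∀ᵐ y ∂((volume : Measure Point).restrict (Omega Ωx t₀ T)),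
      T - η < y.2 → φ y = 0) →
    inner ℝ (dPart h) φ = inner ℝ (vPart h) ρ := by
  refine IsClosedLinear.forall fun φ => IsClosedLinear.forall fun ρ =>
    IsClosedLinear.forall fun _ => IsClosedLinear.forall fun _ => ?_
  -- The Dirichlet condition is Green's formula with no boundary term, hence the zero operator in
  -- the third slot.
  refine (isClosedLinear_inner_sub_inner dPart vPart (0 : Triple Ωx t₀ T →L[ℝ] ℝ) φ ρ
    0).congr fun h => ?_
  rw [inner_zero_right, sub_eq_zero]

/-- Each condition is either tested against fixed L² data or is the kernel of a component
projection. Both are continuous in the triple, although d and the trace are not continuous in v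
alone. -/
theorem isClosedLinear_isGraphTriple (k : ℕ) (spatial : Prop) :
    IsClosedLinear (IsGraphTriple (Ωx := Ωx) (t₀ := t₀) (T := T) k spatial) := by
  have h1 := isClosedLinear_ae (vPart (Ωx := Ωx) (t₀ := t₀) (T := T)) (fun I => I.card ≠ k)
  have h2 := isClosedLinear_ae (dPart (Ωx := Ωx) (t₀ := t₀) (T := T)) (fun I => I.card ≠ k + 1)
  have h3 := isClosedLinear_green (Ωx := Ωx) (t₀ := t₀) (T := T)
  have h4 := isClosedLinear_ae (gPart (Ωx := Ωx) (t₀ := t₀) (T := T)) (fun I => 3 ∈ I)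
  have h5 := isClosedLinear_dirichlet (Ωx := Ωx) (t₀ := t₀) (T := T)
  have h6 : IsClosedLinear fun h : Triple Ωx t₀ T => spatial →
      ∀ᵐ y ∂((volume : Measure Point).restrict (Omega Ωx t₀ T)),
        ∀ I : Finset (Fin 4), (3 : Fin 4) ∈ I → vPart h y I = 0 :=
    IsClosedLinear.forall fun _ => isClosedLinear_ae vPart (fun I => 3 ∈ I)
  refine (h1.and (h2.and (h3.and (h4.and (h5.and h6))))).congr fun h => ?_
  exact ⟨fun hh => ⟨hh.deg, hh.degD, hh.green, hh.trace, hh.dirichlet, hh.noTime⟩,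
    fun hh => ⟨hh.1, hh.2.1, hh.2.2.1, hh.2.2.2.1, hh.2.2.2.2.1, hh.2.2.2.2.2⟩⟩

end Graph

end SpaceTime

/-! ### Operators induced on L² by constant maps and by scalar functions. -/

section L2Operators

variable {X : Type*} [MeasurableSpace X] {μ : Measure X}
  {E : Type*} [NormedAddCommGroup E] [InnerProductSpace ℝ E]

theorem compLpL_toLp {F : Type*} [NormedAddCommGroup F] [NormedSpace ℝ F] (L : E →L[ℝ] F)
    {h : X → E} (hh : MemLp h 2 μ) :
    L.compLpL 2 μ (hh.toLp h) = (L.comp_memLp' hh).toLp (L ∘ h) := by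
  refine Lp.ext ?_
  filter_upwards [L.coeFn_compLpL (hh.toLp h), hh.coeFn_toLp, (L.comp_memLp' hh).coeFn_toLp]
    with x h1 h2 h3
  rw [h1, h2, h3]
  rfl

theorem inner_compLpL [CompleteSpace E] (L : E →L[ℝ] E) (u v : Lp E 2 μ) :
    inner ℝ (L.compLpL 2 μ u) v = inner ℝ u ((ContinuousLinearMap.adjoint L).compLpL 2 μ v) := by
  rw [L2.inner_def, L2.inner_def]
  refine integral_congr_ae ?_
  filter_upwards [L.coeFn_compLpL u, (ContinuousLinearMap.adjoint L).coeFn_compLpL v] with x h1 h2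
  rw [h1, h2, ContinuousLinearMap.adjoint_inner_right]

/-- `A` is the multiplication by `a` on `L²`. -/
def IsMulOp (a : X → ℝ) (A : Lp E 2 μ →L[ℝ] Lp E 2 μ) : Prop :=
  ∀ v, A v =ᵐ[μ] fun x => a x • v x

theorem IsMulOp.inner_comm {a : X → ℝ} {A : Lp E 2 μ →L[ℝ] Lp E 2 μ} (hA : IsMulOp a A)
    (u v : Lp E 2 μ) : inner ℝ (A u) v = inner ℝ u (A v) := by
  rw [L2.inner_def, L2.inner_def]
  refine integral_congr_ae ?_
  filter_upwards [hA u, hA v] with x h1 h2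
  rw [h1, h2, real_inner_smul_left, real_inner_smul_right]

theorem IsMulOp.compLpL_comm {a : X → ℝ} {A : Lp E 2 μ →L[ℝ] Lp E 2 μ} (hA : IsMulOp a A)
    (L : E →L[ℝ] E) (v : Lp E 2 μ) : L.compLpL 2 μ (A v) = A (L.compLpL 2 μ v) := by
  refine Lp.ext ?_
  filter_upwards [L.coeFn_compLpL (A v), L.coeFn_compLpL v, hA v, hA (L.compLpL 2 μ v)]
    with x h1 h2 h3 h4
  rw [h1, h3, h4, h2, map_smul]

theorem IsMulOp.tendsto_integral {b : X → ℝ} {A : Lp E 2 μ →L[ℝ] Lp E 2 μ} (hA : IsMulOp b A)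
    (w : Lp E 2 μ) {h : X → E} (hh : MemLp h 2 μ) {a : ℕ → X → ℝ}
    (ha : ∀ n, AEStronglyMeasurable (a n) μ) {C : ℝ}
    (hC : ∀ n, ∀ᵐ x ∂μ, h x ≠ 0 → |a n x| ≤ C)
    (hlim : ∀ᵐ x ∂μ, h x ≠ 0 → Filter.Tendsto (fun n => a n x) Filter.atTop (nhds (b x))) :
    Filter.Tendsto (fun n => ∫ x, inner ℝ (w x) (a n x • h x) ∂μ) Filter.atTop
      (nhds (inner ℝ w (A (hh.toLp h)))) := by
  have e : inner ℝ w (A (hh.toLp h)) = ∫ x, inner ℝ (w x) (b x • h x) ∂μ := by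
    rw [L2.inner_def]
    refine integral_congr_ae ?_
    filter_upwards [hA (hh.toLp h), hh.coeFn_toLp] with x h1 h2
    rw [h1, h2]
  rw [e]
  exact tendsto_integral_inner_smul w hh ha hC hlim

end L2Operators

/-! ### Product rules for nonsmooth multipliers. -/

namespace SpaceTime

open Filter
open scoped Topology

theorem fderiv_eq_zero_of_notMem_tsupport {φ : Point → Form} {y : Point}
    (hy : y ∉ tsupport φ) : fderiv ℝ φ y = 0 := by
  by_contra h
  exact hy (support_fderiv_subset ℝ h)

theorem dClassical_eq_zero {φ : Point → Form} {y : Point} (hy : y ∉ tsupport φ) :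
    dClassical φ y = 0 := by
  simp [dClassical_eq, fderiv_eq_zero_of_notMem_tsupport hy]

theorem IsTestForm.codiffClassical_eq_zero {U : Set Point} {φ : Point → Form}
    (h : IsTestForm U φ) {y : Point} (hy : y ∉ tsupport φ) : codiffClassical φ y = 0 := by
  simp [codiffClassical_eq h.differentiable, fderiv_eq_zero_of_notMem_tsupport hy]

theorem IsTestForm.memLp_smul_clm {U : Set Point} {φ : Point → Form} (h : IsTestForm U φ)
    (L : Form →L[ℝ] Form) {a : Point → ℝ} (ha : Continuous a) (μ : Measure Point)
    [IsLocallyFiniteMeasure μ] : MemLp (fun y => a y • L (φ y)) 2 μ := by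
  refine (ha.smul (L.continuous.comp h.1.continuous)).memLp_of_hasCompactSupport ?_
  refine HasCompactSupport.of_support_subset_isCompact h.2.1.isCompact fun y hy => ?_
  by_contra h0
  exact hy (by simp [image_eq_zero_of_notMem_tsupport h0])

variable {Ωx : Set Space} {t₀ T : ℝ}

/-- A function `m` that is locally the bounded limit of smooth functions whose partial derivatives
converge boundedly to `b`. -/
def IsMultiplier (Ωx : Set Space) (t₀ T : ℝ) (m : Point → ℝ) (b : Fin 4 → Point → ℝ) : Prop :=
  ∀ K : Set Point, IsCompact K → K ⊆ Ωx ×ˢ univ → ∃ (M : ℕ → Point → ℝ) (C : ℝ),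
    (∀ n, ContDiff ℝ ∞ (M n)) ∧ (∀ n, ∀ y ∈ K, |M n y| ≤ C) ∧
    (∀ n j, ∀ y ∈ K, |fderiv ℝ (M n) y (dir j)| ≤ C) ∧
    (∀ᵐ y ∂(volume.restrict (Omega Ωx t₀ T)), Tendsto (fun n => M n y) atTop (𝓝 (m y))) ∧
    (∀ j, ∀ᵐ y ∂(volume.restrict (Omega Ωx t₀ T)), y ∈ K →
      Tendsto (fun n => fderiv ℝ (M n) y (dir j)) atTop (𝓝 (b j y))) ∧
    (∀ᵐ x ∂(volume.restrict Ωx), Tendsto (fun n => M n (x, T)) atTop (𝓝 (m (x, T))))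

/-- Exterior multiplication by `dx^j` on `L²`. -/
def extL2 (Ωx : Set Space) (t₀ T : ℝ) (j : Fin 4) : L2Form Ωx t₀ T →L[ℝ] L2Form Ωx t₀ T :=
  (extMul j).compLpL 2 _

/-- The adjoint of exterior multiplication by `dx^j` on `L²`. -/
def intL2 (Ωx : Set Space) (t₀ T : ℝ) (j : Fin 4) : L2Form Ωx t₀ T →L[ℝ] L2Form Ωx t₀ T :=
  (ContinuousLinearMap.adjoint (extMul j)).compLpL 2 _

theorem inner_extL2 (j : Fin 4) (u v : L2Form Ωx t₀ T) :
    inner ℝ (extL2 Ωx t₀ T j u) v = inner ℝ u (intL2 Ωx t₀ T j v) := inner_compLpL _ u v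

section Product

variable {m : Point → ℝ} {b : Fin 4 → Point → ℝ}
  {A : L2Form Ωx t₀ T →L[ℝ] L2Form Ωx t₀ T} {B : Fin 4 → L2Form Ωx t₀ T →L[ℝ] L2Form Ωx t₀ T}
  {AT : L2Terminal Ωx →L[ℝ] L2Terminal Ωx}

theorem inner_mulOp_extL2 {a : Point → ℝ} (hA : IsMulOp a A) (j : Fin 4) (u v : L2Form Ωx t₀ T) :
    inner ℝ (A (extL2 Ωx t₀ T j u)) v = inner ℝ u (A (intL2 Ωx t₀ T j v)) := by
  rw [hA.inner_comm, inner_extL2]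
  congr 1
  exact hA.compLpL_comm _ v

theorem inner_mulOp_intL2 {a : Point → ℝ} (hA : IsMulOp a A) (j : Fin 4) (u v : L2Form Ωx t₀ T) :
    inner ℝ (A (intL2 Ωx t₀ T j u)) v = inner ℝ u (A (extL2 Ωx t₀ T j v)) := by
  have h1 : A (extL2 Ωx t₀ T j v) = extL2 Ωx t₀ T j (A v) := (hA.compLpL_comm _ v).symm
  rw [hA.inner_comm, h1, real_inner_comm, ← inner_extL2, real_inner_comm]

theorem integrable_inner_test {U : Set Point} {φ : Point → Form} (hφ : IsTestForm U φ)
    (v : L2Form Ωx t₀ T) (L : Form →L[ℝ] Form) {a : Point → ℝ} (ha : Continuous a) :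
    Integrable (fun y => inner ℝ (v y) (a y • L (φ y))) (volume.restrict (Omega Ωx t₀ T)) :=
  integrable_inner_Lp v (hφ.memLp_smul_clm L ha _)

/-- Green's formula with a terminal boundary term. -/
def IsGreen (v w : L2Form Ωx t₀ T) (g : L2Terminal Ωx) : Prop :=
  ∀ φ : Point → Form, IsTestForm (Ωx ×ˢ Ioi t₀) φ →
    (∫ y in Omega Ωx t₀ T, inner ℝ (w y) (φ y))
      - (∫ y in Omega Ωx t₀ T, inner ℝ (v y) (codiffClassical φ y))
      = ∫ x in Ωx, inner ℝ (wedge (dx 3) (g x)) (φ (x, T))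

theorem isGreen_iff (v w : L2Form Ωx t₀ T) (g : L2Terminal Ωx) :
    IsGreen v w g ↔ ∀ (φ : Point → Form) (hφ : IsTestForm (Ωx ×ˢ Ioi t₀) φ),
      inner ℝ w ((hφ.memLp (volume.restrict (Omega Ωx t₀ T))).toLp φ)
        - inner ℝ v ((hφ.memLp_codiffClassical (volume.restrict (Omega Ωx t₀ T))).toLp _)
        = inner ℝ (extT Ωx g) ((hφ.memLp_slice T (volume.restrict Ωx)).toLp _) := by
  refine forall_congr' fun φ => forall_congr' fun hφ => ?_
  rw [integral_inner_eq_inner_toLp _ (hφ.memLp _),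
    integral_inner_eq_inner_toLp _ (hφ.memLp_codiffClassical _),
    integral_extMul_slice _ (hφ.memLp_slice T _)]

/-- Green's formula tested with the product of a smooth function and a test form. -/
theorem IsGreen.smul_test {v w : L2Form Ωx t₀ T} {g : L2Terminal Ωx} (h : IsGreen v w g)
    {φ : Point → Form} (hφ : IsTestForm (Ωx ×ˢ Ioi t₀) φ) {M : Point → ℝ} (hM : ContDiff ℝ ∞ M) :
    (∫ y in Omega Ωx t₀ T, inner ℝ (w y) (M y • φ y))
      - ((∫ y in Omega Ωx t₀ T, inner ℝ (v y) (M y • codiffClassical φ y))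
        - ∑ j, ∫ y in Omega Ωx t₀ T, inner ℝ (v y) (fderiv ℝ M y (dir j) •
          ContinuousLinearMap.adjoint (extMul j) (φ y)))
      = ∫ x in Ωx, inner ℝ (extT Ωx g x) (M (x, T) • φ (x, T)) := by
  have hMd : ∀ j, Continuous fun y => fderiv ℝ M y (dir j) := fun j =>
    (hM.continuous_fderiv (by simp)).clm_apply continuous_const
  have ht := hφ.smul hM
  have i0 := integrable_inner_Lp v
    (ht.memLp_codiffClassical ((volume : Measure Point).restrict (Omega Ωx t₀ T)))
  have i2 := fun j : Fin 4 => integrable_inner_test hφ v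
    (ContinuousLinearMap.adjoint (extMul j)) (hMd j)
  have e1 : ∀ y, inner ℝ (v y) (M y • codiffClassical φ y) =
      inner ℝ (v y) (codiffClassical (fun y => M y • φ y) y) +
      ∑ j, inner ℝ (v y) (fderiv ℝ M y (dir j) •
        ContinuousLinearMap.adjoint (extMul j) (φ y)) := by
    intro y
    rw [hφ.codiffClassical_smul hM, inner_sub_right, inner_sum]
    ring
  simp only [e1]
  rw [integral_add i0 (integrable_finsetSum _ fun j _ => i2 j),
    integral_finsetSum _ fun j _ => i2 j, add_sub_cancel_right, h _ ht]
  refine integral_congr_ae ?_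
  filter_upwards [(extMul 3).coeFn_compLpL (p := 2) g] with x hx
  change _ = inner ℝ (((extMul 3).compLpL 2 (volume.restrict Ωx) g) x) _
  rw [hx]
  rfl

/-- Dominated convergence in `IsGreen.smul_test`. It is enough to approximate on the support of φ, a
compact set that may cross t = T, because φ, its codifferential and its terminal slice all vanish
off it. -/
theorem IsMultiplier.green_limit (hm : IsMultiplier Ωx t₀ T m b) (hA : IsMulOp m A)
    (hB : ∀ j, IsMulOp (b j) (B j)) (hAT : IsMulOp (fun x => m (x, T)) AT)
    {v w : L2Form Ωx t₀ T} {g : L2Terminal Ωx} (h : IsGreen v w g)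
    {φ : Point → Form} (hφ : IsTestForm (Ωx ×ˢ Ioi t₀) φ) :
    inner ℝ w (A ((hφ.memLp (volume.restrict (Omega Ωx t₀ T))).toLp φ))
      - (inner ℝ v (A ((hφ.memLp_codiffClassical (volume.restrict (Omega Ωx t₀ T))).toLp _))
        - ∑ j, inner ℝ v (B j (intL2 Ωx t₀ T j
          ((hφ.memLp (volume.restrict (Omega Ωx t₀ T))).toLp φ))))
      = inner ℝ (extT Ωx g) (AT ((hφ.memLp_slice T (volume.restrict Ωx)).toLp _)) := by
  obtain ⟨M, C, hMs, hMC, hMC', hM1, hM2, hM3⟩ := hm (tsupport φ) hφ.2.1.isCompact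
    (hφ.2.2.trans (prod_mono subset_rfl (subset_univ _)))
  have m1 := hφ.memLp ((volume : Measure Point).restrict (Omega Ωx t₀ T))
  have m2 := hφ.memLp_codiffClassical ((volume : Measure Point).restrict (Omega Ωx t₀ T))
  have m3 := hφ.memLp_slice T ((volume : Measure Space).restrict Ωx)
  have hMd : ∀ n j, Continuous fun y => fderiv ℝ (M n) y (dir j) := fun n j =>
    ((hMs n).continuous_fderiv (by simp)).clm_apply continuous_const
  have l1 := hA.tendsto_integral w m1 (a := M) (C := C)
    (fun n => (hMs n).continuous.aestronglyMeasurable)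
    (fun n => Eventually.of_forall fun y hy => hMC n y (subset_tsupport _ hy))
    (hM1.mono fun y hy _ => hy)
  have l2 := hA.tendsto_integral v m2 (a := M) (C := C)
    (fun n => (hMs n).continuous.aestronglyMeasurable)
    (fun n => Eventually.of_forall fun y hy => hMC n y
      (by_contra fun h0 => hy (hφ.codiffClassical_eq_zero h0)))
    (hM1.mono fun y hy _ => hy)
  have hsupp : ∀ (L : Form →L[ℝ] Form) y, L (φ y) ≠ 0 → y ∈ tsupport φ := fun L y hy =>
    by_contra fun h0 => hy (by rw [image_eq_zero_of_notMem_tsupport h0, map_zero])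
  have l3 := fun j => (hB j).tendsto_integral v
    ((ContinuousLinearMap.adjoint (extMul j)).comp_memLp' m1)
    (a := fun n y => fderiv ℝ (M n) y (dir j)) (C := C)
    (fun n => (hMd n j).aestronglyMeasurable)
    (fun n => Eventually.of_forall fun y hy => hMC' n j y (hsupp _ y hy))
    ((hM2 j).mono fun y hy h0 => hy (hsupp _ y h0))
  have l4 := hAT.tendsto_integral (extT Ωx g) m3 (a := fun n x => M n (x, T)) (C := C)
    (fun n => ((hMs n).continuous.comp (by fun_prop)).aestronglyMeasurable)
    (fun n => Eventually.of_forall fun x hx => hMC n (x, T) (subset_tsupport _ hx))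
    (hM3.mono fun y hy _ => hy)
  have key := tendsto_nhds_unique ((l1.sub (l2.sub (tendsto_finsetSum _ fun j _ => l3 j))).congr
    fun n => h.smul_test hφ (hMs n)) l4
  simp only [intL2, compLpL_toLp]
  exact key

/-- The product rule in Green's formula with a terminal boundary term. -/
theorem IsMultiplier.isGreen (hm : IsMultiplier Ωx t₀ T m b) (hA : IsMulOp m A)
    (hB : ∀ j, IsMulOp (b j) (B j)) (hAT : IsMulOp (fun x => m (x, T)) AT)
    {v w : L2Form Ωx t₀ T} {g : L2Terminal Ωx} (h : IsGreen v w g) :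
    IsGreen (A v) (A w + ∑ j, B j (extL2 Ωx t₀ T j v)) (AT g) := by
  rw [isGreen_iff]
  intro φ hφ
  have e2 : extT Ωx (AT g) = AT (extT Ωx g) := hAT.compLpL_comm _ g
  rw [inner_add_left, sum_inner, hA.inner_comm, hA.inner_comm, e2, hAT.inner_comm,
    ← hm.green_limit hA hB hAT h hφ]
  simp only [inner_mulOp_extL2 (hB _)]
  ring

theorem IsWeakCodiff.smul_test {φ ρ : L2Form Ωx t₀ T}
    (h : IsWeakCodiff (Omega Ωx t₀ T) φ ρ) {ζ : Point → Form}
    (hζ : IsTestForm (Omega Ωx t₀ T) ζ) {M : Point → ℝ} (hM : ContDiff ℝ ∞ M) :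
    (∫ y in Omega Ωx t₀ T, inner ℝ (φ y) (M y • dClassical ζ y))
        + ∑ j, ∫ y in Omega Ωx t₀ T, inner ℝ (φ y) (fderiv ℝ M y (dir j) • extMul j (ζ y))
      = ∫ y in Omega Ωx t₀ T, inner ℝ (ρ y) (M y • ζ y) := by
  have hMd : ∀ j, Continuous fun y => fderiv ℝ M y (dir j) := fun j =>
    (hM.continuous_fderiv (by simp)).clm_apply continuous_const
  have ht := hζ.smul hM
  have i0 := integrable_inner_Lp φ
    (ht.memLp_dClassical ((volume : Measure Point).restrict (Omega Ωx t₀ T)))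
  have i2 := fun j : Fin 4 => integrable_inner_test hζ φ (extMul j) (hMd j)
  have e1 : ∀ y, inner ℝ (φ y) (M y • dClassical ζ y) =
      inner ℝ (φ y) (dClassical (fun y => M y • ζ y) y) -
      ∑ j, inner ℝ (φ y) (fderiv ℝ M y (dir j) • extMul j (ζ y)) := by
    intro y
    rw [hζ.dClassical_smul hM, inner_add_right, inner_sum]
    ring
  simp only [e1]
  rw [integral_sub i0 (integrable_finsetSum _ fun j _ => i2 j),
    integral_finsetSum _ fun j _ => i2 j, sub_add_cancel, h _ ht]

/-- The same limit for the codifferential. The test form is supported inside the cylinder, so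
convergence on the terminal slice plays no role. -/
theorem IsMultiplier.codiff_limit (hm : IsMultiplier Ωx t₀ T m b) (hA : IsMulOp m A)
    (hB : ∀ j, IsMulOp (b j) (B j)) {φ ρ : L2Form Ωx t₀ T}
    (h : IsWeakCodiff (Omega Ωx t₀ T) φ ρ) {ζ : Point → Form}
    (hζ : IsTestForm (Omega Ωx t₀ T) ζ) :
    inner ℝ φ (A ((hζ.memLp_dClassical (volume.restrict (Omega Ωx t₀ T))).toLp _))
      + ∑ j, inner ℝ φ (B j (extL2 Ωx t₀ T j
        ((hζ.memLp (volume.restrict (Omega Ωx t₀ T))).toLp ζ)))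
      = inner ℝ ρ (A ((hζ.memLp (volume.restrict (Omega Ωx t₀ T))).toLp ζ)) := by
  obtain ⟨M, C, hMs, hMC, hMC', hM1, hM2, -⟩ := hm (tsupport ζ) hζ.2.1.isCompact
    (hζ.2.2.trans (prod_mono subset_rfl (subset_univ _)))
  have m1 := hζ.memLp ((volume : Measure Point).restrict (Omega Ωx t₀ T))
  have m2 := hζ.memLp_dClassical ((volume : Measure Point).restrict (Omega Ωx t₀ T))
  have hMd : ∀ n j, Continuous fun y => fderiv ℝ (M n) y (dir j) := fun n j =>
    ((hMs n).continuous_fderiv (by simp)).clm_apply continuous_const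
  have l1 := hA.tendsto_integral ρ m1 (a := M) (C := C)
    (fun n => (hMs n).continuous.aestronglyMeasurable)
    (fun n => Eventually.of_forall fun y hy => hMC n y (subset_tsupport _ hy))
    (hM1.mono fun y hy _ => hy)
  have l2 := hA.tendsto_integral φ m2 (a := M) (C := C)
    (fun n => (hMs n).continuous.aestronglyMeasurable)
    (fun n => Eventually.of_forall fun y hy => hMC n y
      (by_contra fun h0 => hy (dClassical_eq_zero h0)))
    (hM1.mono fun y hy _ => hy)
  have hsupp : ∀ (L : Form →L[ℝ] Form) y, L (ζ y) ≠ 0 → y ∈ tsupport ζ := fun L y hy =>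
    by_contra fun h0 => hy (by rw [image_eq_zero_of_notMem_tsupport h0, map_zero])
  have l3 := fun j => (hB j).tendsto_integral φ ((extMul j).comp_memLp' m1)
    (a := fun n y => fderiv ℝ (M n) y (dir j)) (C := C)
    (fun n => (hMd n j).aestronglyMeasurable)
    (fun n => Eventually.of_forall fun y hy => hMC' n j y (hsupp _ y hy))
    ((hM2 j).mono fun y hy h0 => hy (hsupp _ y h0))
  have key := tendsto_nhds_unique ((l2.add (tendsto_finsetSum _ fun j _ => l3 j)).congr
    fun n => h.smul_test hζ (hMs n)) l1
  simp only [extL2, compLpL_toLp]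
  exact key

/-- The product rule for the weak codifferential. -/
theorem IsMultiplier.isWeakCodiff (hm : IsMultiplier Ωx t₀ T m b) (hA : IsMulOp m A)
    (hB : ∀ j, IsMulOp (b j) (B j)) {φ ρ : L2Form Ωx t₀ T}
    (h : IsWeakCodiff (Omega Ωx t₀ T) φ ρ) :
    IsWeakCodiff (Omega Ωx t₀ T) (A φ) ((A ρ - ∑ j, B j (intL2 Ωx t₀ T j φ) :
      L2Form Ωx t₀ T)) := by
  intro ζ hζ
  rw [integral_inner_eq_inner_toLp _ (hζ.memLp _),
    integral_inner_eq_inner_toLp _ (hζ.memLp_dClassical _),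
    inner_sub_left, sum_inner, hA.inner_comm, hA.inner_comm, ← hm.codiff_limit hA hB h hζ]
  simp only [inner_mulOp_intL2 (hB _)]
  ring

theorem _root_.IsMulOp.apply_eq_zero {X : Type*} [MeasurableSpace X] {μ : Measure X} {a : X → ℝ}
    {A : Lp Form 2 μ →L[ℝ] Lp Form 2 μ} (hA : IsMulOp a A) {p : Finset (Fin 4) → Prop}
    {v : Lp Form 2 μ} (hv : ∀ᵐ x ∂μ, ∀ I, p I → v x I = 0) :
    ∀ᵐ x ∂μ, ∀ I, p I → A v x I = 0 := by
  filter_upwards [hA v, hv] with x h1 h2 I hI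
  rw [h1, PiLp.smul_apply, h2 I hI, smul_zero]

theorem extL2_mem {k : ℕ} (j : Fin 4) {v : L2Form Ωx t₀ T} (hv : v ∈ L2Lambda Ωx t₀ T k) :
    extL2 Ωx t₀ T j v ∈ L2Lambda Ωx t₀ T (k + 1) := by
  have hv' : ∀ᵐ y ∂(volume.restrict (Omega Ωx t₀ T)),
    ∀ I : Finset (Fin 4), I.card ≠ k → v y I = 0 := hv
  change ∀ᵐ y ∂(volume.restrict (Omega Ωx t₀ T)),
    ∀ I : Finset (Fin 4), I.card ≠ k + 1 → extL2 Ωx t₀ T j v y I = 0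
  filter_upwards [(extMul j).coeFn_compLpL (p := 2) v, hv'] with y h1 h2 I hI
  have h3 : extL2 Ωx t₀ T j v y = extMul j (v y) := h1
  rw [h3, extMul_coeff]
  split_ifs with hj
  · rw [h2, mul_zero]
    intro h4
    rw [Finset.sdiff_singleton_eq_erase, Finset.card_erase_of_mem hj] at h4
    have := Finset.card_pos.2 ⟨j, hj⟩
    exact hI (by omega)
  · rfl

theorem add_sum_apply_eq_zero {X : Type*} [MeasurableSpace X] {μ : Measure X}
    {p : Finset (Fin 4) → Prop} {w : Lp Form 2 μ} {z : Fin 4 → Lp Form 2 μ}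
    (hw : ∀ᵐ x ∂μ, ∀ I, p I → w x I = 0) (hz : ∀ j, ∀ᵐ x ∂μ, ∀ I, p I → z j x I = 0) :
    ∀ᵐ x ∂μ, ∀ I, p I → (w + ∑ j, z j : Lp Form 2 μ) x I = 0 := by
  filter_upwards [hw, ae_all_iff.2 hz, Lp.coeFn_add w (∑ j, z j),
    Lp.coeFn_finsetSum Finset.univ z] with x h1 h2 h3 h4 I hI
  rw [h3, Pi.add_apply, h4]
  simp [h1 I hI, fun j => h2 j I hI]

/-- The multiplier is moved to the test field: m φ still vanishes near Γ_T and has a weak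
codifferential in L² by `IsMultiplier.isWeakCodiff`, so it is admissible in the condition for v.
Taking adjoints gives the condition for m v, without any regularity of the boundary. -/
theorem IsMultiplier.dirichlet (hm : IsMultiplier Ωx t₀ T m b) (hA : IsMulOp m A)
    (hB : ∀ j, IsMulOp (b j) (B j)) {v w : L2Form Ωx t₀ T}
    (h : ∀ φ ρ : L2Form Ωx t₀ T, IsWeakCodiff (Omega Ωx t₀ T) φ ρ →
      (∃ η > 0, ∀ᵐ y ∂((volume : Measure Point).restrict (Omega Ωx t₀ T)),
        T - η < y.2 → φ y = 0) → inner ℝ w φ = inner ℝ v ρ) (φ ρ : L2Form Ωx t₀ T)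
    (h1 : IsWeakCodiff (Omega Ωx t₀ T) φ ρ)
    (h2 : ∃ η > 0, ∀ᵐ y ∂((volume : Measure Point).restrict (Omega Ωx t₀ T)),
        T - η < y.2 → φ y = 0) :
    inner ℝ (A w + ∑ j, B j (extL2 Ωx t₀ T j v)) φ = inner ℝ (A v) ρ := by
  have h3 := h _ _ (hm.isWeakCodiff hA hB h1) (by
    obtain ⟨η, hη, h4⟩ := h2
    refine ⟨η, hη, ?_⟩
    filter_upwards [h4, hA φ] with y h5 h6 h7
    rw [h6, h5 h7, smul_zero])
  rw [inner_sub_right, inner_sum] at h3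
  rw [inner_add_left, sum_inner, hA.inner_comm, hA.inner_comm, h3]
  simp only [inner_mulOp_extL2 (hB _)]
  ring

/-- Multiplication by a multiplier preserves `HΛ^k_D(Ω)`. -/
theorem IsMultiplier.isGraphTriple (hm : IsMultiplier Ωx t₀ T m b) (hA : IsMulOp m A)
    (hB : ∀ j, IsMulOp (b j) (B j)) (hAT : IsMulOp (fun x => m (x, T)) AT) {k : ℕ} {spatial : Prop}
    {h : Triple Ωx t₀ T} (hh : IsGraphTriple k spatial h) :
    IsGraphTriple k spatial (mkTriple (A (dPart h) + ∑ j, B j (extL2 Ωx t₀ T j (vPart h)))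
      (A (vPart h)) (AT (gPart h))) where
  deg := hA.apply_eq_zero hh.deg
  degD := add_sum_apply_eq_zero (hA.apply_eq_zero hh.degD)
    fun j => (hB j).apply_eq_zero (extL2_mem j hh.deg)
  green := hm.isGreen hA hB hAT hh.green
  trace := hAT.apply_eq_zero hh.trace
  dirichlet := hm.dirichlet hA hB hh.dirichlet
  noTime hs := hA.apply_eq_zero (hh.noTime hs)

end Product

end SpaceTime

/-! ### The spatial potential and the exponential weight. -/

namespace SpaceTime

open Filter
open scoped Topology

variable {Ωx : Set Space} {t₀ T : ℝ}

theorem dir_castSucc (i : Fin 3) : dir i.castSucc = (EuclideanSpace.single i 1, 0) := by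
  simp [dir]

theorem dir_three : dir 3 = (0, 1) := by
  simp [dir]

theorem extMul_zeroForm (j : Fin 4) (ψ : Point → ℝ) (y : Point) (i : Fin 4) :
    extMul j (zeroForm ψ y) {i} = if j = i then ψ y else 0 := by
  rw [extMul_coeff]
  by_cases h : j = i
  · subst h
    simp [zeroForm, wedgeSign]
  · simp [h]

/-- Reads the weak equation dψ = b₁ coefficientwise: testing with f dx^i produces the scalar weak
derivative in direction i. -/
theorem inner_zeroForm_codiffClassical {ψ f : Point → ℝ} {y : Point} {i : Fin 4}
    (hf : Differentiable ℝ f) :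
    inner ℝ (zeroForm ψ y) (codiffClassical (fun z => f z • (EuclideanSpace.single {i} 1 : Form)) y)
      = - (ψ y * fderiv ℝ f y (dir i)) := by
  have hd : ∀ v, fderiv ℝ (fun z => f z • (EuclideanSpace.single {i} 1 : Form)) y v =
      fderiv ℝ f y v • (EuclideanSpace.single {i} 1 : Form) := by
    intro v
    rw [fderiv_smul_const (hf y)]
    rfl
  rw [codiffClassical_eq (hf.smul_const _), inner_neg_right, inner_sum]
  simp only [ContinuousLinearMap.adjoint_inner_right, hd, inner_smul_single, extMul_zeroForm]
  simp [mul_comm]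

theorem fderiv_mul_prod {η : Space → ℝ} {θ : ℝ → ℝ} (hη : Differentiable ℝ η)
    (hθ : Differentiable ℝ θ) (y : Point) (e : Space) :
    fderiv ℝ (fun z : Point => η z.1 * θ z.2) y (e, 0) = fderiv ℝ η y.1 e * θ y.2 := by
  have h1 : HasFDerivAt (fun z : Point => η z.1)
      ((fderiv ℝ η y.1).comp (ContinuousLinearMap.fst ℝ Space ℝ)) y :=
    (hη y.1).hasFDerivAt.comp y hasFDerivAt_fst
  have h2 : HasFDerivAt (fun z : Point => θ z.2)
      ((fderiv ℝ θ y.2).comp (ContinuousLinearMap.snd ℝ Space ℝ)) y :=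
    (hθ y.2).hasFDerivAt.comp y hasFDerivAt_snd
  have h3 : HasFDerivAt (fun z : Point => η z.1 * θ z.2) _ y := h1.mul h2
  rw [h3.fderiv]
  simp [mul_comm]

theorem volume_restrict_Omega : (volume : Measure Point).restrict (Omega Ωx t₀ T) =
    ((volume : Measure Space).restrict Ωx).prod ((volume : Measure ℝ).restrict (Ioo t₀ T)) := by
  rw [Measure.prod_restrict]
  rfl

theorem ae_Omega_of_ae {p : Space → Prop} (h : ∀ᵐ x ∂((volume : Measure Space).restrict Ωx), p x) :
    ∀ᵐ y ∂((volume : Measure Point).restrict (Omega Ωx t₀ T)), p y.1 := by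
  rw [volume_restrict_Omega]
  exact Measure.quasiMeasurePreserving_fst.ae h

/-- Averaging a bounded space-time potential in time gives a bounded potential in space. -/
theorem exists_spatial_potential {α : Space → ℝ} {β : Space → Space} {ε : ℝ} (hΩo : IsOpen Ωx)
    (hT : t₀ < T)
    (ψ₀ : Point → ℝ) (hψm : AEMeasurable ψ₀ (volume.restrict (Omega Ωx t₀ T)))
    (hψb : ∃ M : ℝ, ∀ y ∈ Omega Ωx t₀ T, |ψ₀ y| ≤ M)
    (hψ : IsWeakD (Omega Ωx t₀ T) (zeroForm ψ₀) (convectionForm α β ε)) :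
    ∃ (χ : Space → ℝ) (M : ℝ), AEStronglyMeasurable χ (volume.restrict Ωx) ∧
      (∀ x ∈ Ωx, |χ x| ≤ M) ∧ ∀ i : Fin 3, ∀ η : Space → ℝ, ContDiff ℝ ∞ η → HasCompactSupport η →
        tsupport η ⊆ Ωx → ∫ x in Ωx, ((α x)⁻¹ * β x i) * η x =
          - ∫ x in Ωx, χ x * fderiv ℝ η x (EuclideanSpace.single i 1) := by
  obtain ⟨M, hM⟩ := hψb
  let c : ContDiffBump ((t₀ + T) / 2) :=
    ⟨(T - t₀) / 8, (T - t₀) / 4, by linarith, by linarith⟩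
  let θ : ℝ → ℝ := c.normed volume
  have hθs : ContDiff ℝ ∞ θ := c.contDiff_normed
  have hθc : HasCompactSupport θ := c.hasCompactSupport_normed
  have hθI : tsupport θ ⊆ Ioo t₀ T := by
    rw [c.tsupport_normed_eq, Real.closedBall_eq_Icc]
    intro s hs
    simp only [c, mem_Icc, mem_Ioo] at hs ⊢
    constructor <;> linarith
  have hθ1 : ∫ t in Ioo t₀ T, θ t = 1 := by
    rw [setIntegral_eq_integral_of_forall_compl_eq_zero, c.integral_normed]
    exact fun t ht => image_eq_zero_of_notMem_tsupport fun h => ht (hθI h)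
  have hθi : Integrable θ (volume.restrict (Ioo t₀ T)) := c.integrable_normed.restrict
  have hmeas : AEStronglyMeasurable (fun y : Point => ψ₀ y * θ y.2)
      (volume.restrict (Omega Ωx t₀ T)) :=
    hψm.aestronglyMeasurable.mul
      (hθs.continuous.comp continuous_snd).aestronglyMeasurable
  -- A time average against a smooth probability density supported in (t₀, T): products η θ are then
  -- test functions in the cylinder, and the bound on ψ₀ survives.
  refine ⟨fun x => ∫ t in Ioo t₀ T, ψ₀ (x, t) * θ t, M, ?_, ?_, ?_⟩
  · rw [volume_restrict_Omega] at hmeas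
    exact hmeas.integral_prod_right'
  · intro x hx
    rw [← Real.norm_eq_abs]
    refine (norm_integral_le_of_norm_le (hθi.const_mul M) ?_).trans_eq ?_
    · rw [ae_restrict_iff' measurableSet_Ioo]
      refine Eventually.of_forall fun t ht => ?_
      rw [norm_mul, Real.norm_eq_abs, Real.norm_eq_abs, abs_of_nonneg (c.nonneg_normed t)]
      exact mul_le_mul_of_nonneg_right (hM _ ⟨hx, ht⟩) (c.nonneg_normed t)
    · rw [integral_const_mul, hθ1, mul_one]
  · intro i η hη hηc hηΩ
    have hφ := isTestForm_prod hη hηc hηΩ hθs hθc hθI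
      (EuclideanSpace.single {i.castSucc} 1 : Form)
    have h1 := hψ _ hφ
    have hd : Differentiable ℝ fun y : Point => η y.1 * θ y.2 := by
      have : ContDiff ℝ ∞ fun y : Point => η y.1 * θ y.2 := by fun_prop
      exact this.differentiable (by simp)
    simp only [inner_smul_single, convectionForm_castSucc, inner_zeroForm_codiffClassical hd,
      dir_castSucc, fderiv_mul_prod (hη.differentiable (by simp)) (hθs.differentiable (by simp))]
      at h1
    -- The spatial coefficients of b₁ are independent of t, so Fubini and ∫ θ = 1 remove the time
    -- integral.
    have e1 : ∫ y in Omega Ωx t₀ T, η y.1 * θ y.2 * ((α y.1)⁻¹ * β y.1 i) =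
        ∫ x in Ωx, ((α x)⁻¹ * β x i) * η x := by
      have h2 := setIntegral_prod_mul (μ := (volume : Measure Space)) (ν := (volume : Measure ℝ))
        (fun x => ((α x)⁻¹ * β x i) * η x) θ Ωx (Ioo t₀ T)
      rw [hθ1, mul_one] at h2
      rw [← h2]
      refine integral_congr_ae (Eventually.of_forall fun y => ?_)
      simp only
      ring
    rw [e1] at h1
    rw [h1, integral_neg]
    congr 1
    have hηd : Continuous fun x => fderiv ℝ η x (EuclideanSpace.single i 1) :=
      (hη.continuous_fderiv (by simp)).clm_apply continuous_const
    have hint : IntegrableOn (fun y : Point => ψ₀ y *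
        (fderiv ℝ η y.1 (EuclideanSpace.single i 1) * θ y.2)) (Ωx ×ˢ Ioo t₀ T)
        ((volume : Measure Space).prod (volume : Measure ℝ)) := by
      have hc : Integrable (fun y : Point => fderiv ℝ η y.1 (EuclideanSpace.single i 1) * θ y.2)
          (volume.restrict (Omega Ωx t₀ T)) :=
        (Integrable.mul_prod (μ := (volume : Measure Space)) (ν := (volume : Measure ℝ))
          (hηd.integrable_of_hasCompactSupport (hηc.fderiv_apply (𝕜 := ℝ) _))
          c.integrable_normed).restrict
      refine hc.bdd_mul (c := M) hψm.aestronglyMeasurable ?_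
      exact (ae_restrict_iff' (isOpen_Omega hΩo).measurableSet).2
        (Eventually.of_forall fun y hy => hM y hy)
    have h3 := setIntegral_prod _ hint
    have h4 : ∀ x, ∫ t in Ioo t₀ T, ψ₀ (x, t) *
        (fderiv ℝ η x (EuclideanSpace.single i 1) * θ t) =
        (∫ t in Ioo t₀ T, ψ₀ (x, t) * θ t) * fderiv ℝ η x (EuclideanSpace.single i 1) := by
      intro x
      rw [← integral_mul_const]
      exact integral_congr_ae (Eventually.of_forall fun t => by simp only; ring)
    simp only [h4] at h3
    exact h3

/-- The exponential of minus the potential `χ - t/ε`. -/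
def expWeight (χ : Space → ℝ) (ε : ℝ) (y : Point) : ℝ := Real.exp (-χ y.1 + y.2 / ε)

theorem hasFDerivAt_expWeight {F : Space → ℝ} (hF : Differentiable ℝ F) (ε : ℝ) (y : Point) :
    HasFDerivAt (expWeight F ε) (expWeight F ε y •
      (-((fderiv ℝ F y.1).comp (ContinuousLinearMap.fst ℝ Space ℝ)) +
        ε⁻¹ • ContinuousLinearMap.snd ℝ Space ℝ)) y := by
  have h1 : HasFDerivAt (fun z : Point => F z.1)
      ((fderiv ℝ F y.1).comp (ContinuousLinearMap.fst ℝ Space ℝ)) y :=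
    (hF y.1).hasFDerivAt.comp y hasFDerivAt_fst
  have h2 : HasFDerivAt (fun z : Point => z.2 / ε)
      (ε⁻¹ • ContinuousLinearMap.snd ℝ Space ℝ) y := by
    simp only [div_eq_inv_mul]
    exact (hasFDerivAt_snd (𝕜 := ℝ) (p := y)).const_mul ε⁻¹
  exact (h1.neg.add h2).exp

theorem fderiv_expWeight_castSucc {F : Space → ℝ} (hF : Differentiable ℝ F) (ε : ℝ) (y : Point)
    (i : Fin 3) : fderiv ℝ (expWeight F ε) y (dir i.castSucc) =
      -(expWeight F ε y * fderiv ℝ F y.1 (EuclideanSpace.single i 1)) := by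
  rw [(hasFDerivAt_expWeight hF ε y).fderiv, dir_castSucc]
  simp

theorem fderiv_expWeight_three {F : Space → ℝ} (hF : Differentiable ℝ F) (ε : ℝ) (y : Point) :
    fderiv ℝ (expWeight F ε) y (dir 3) = expWeight F ε y * ε⁻¹ := by
  rw [(hasFDerivAt_expWeight hF ε y).fderiv, dir_three]
  simp

theorem expWeight_le {χ : Space → ℝ} {ε M R : ℝ} (hε : 0 < ε) {y : Point} (h : |χ y.1| ≤ M)
    (hy : y.2 ≤ R) : expWeight χ ε y ≤ Real.exp (M + R / ε) := by
  refine Real.exp_le_exp.2 (add_le_add ((neg_le_abs _).trans h) ?_)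
  exact div_le_div_of_nonneg_right hy hε.le

theorem abs_expWeight (χ : Space → ℝ) (ε : ℝ) (y : Point) :
    |expWeight χ ε y| = expWeight χ ε y := abs_of_pos (Real.exp_pos _)

/-- The weight is a multiplier with gradient `- m b₁`. -/
theorem isMultiplier_expWeight {α : Space → ℝ} {β : Space → Space} {ε : ℝ} (hΩo : IsOpen Ωx)
    (hε : 0 < ε)
    (hαm : AEMeasurable α (volume.restrict Ωx)) (hβm : AEMeasurable β (volume.restrict Ωx))
    (hbdd : ∃ M : ℝ, ∀ x ∈ Ωx, ‖(α x)⁻¹ • β x‖ ≤ M)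
    {χ : Space → ℝ} (hχm : AEStronglyMeasurable χ (volume.restrict Ωx))
    (hχb : ∃ M : ℝ, ∀ x ∈ Ωx, |χ x| ≤ M)
    (hχ : ∀ i : Fin 3, ∀ η : Space → ℝ, ContDiff ℝ ∞ η → HasCompactSupport η →
        tsupport η ⊆ Ωx → ∫ x in Ωx, ((α x)⁻¹ * β x i) * η x =
          - ∫ x in Ωx, χ x * fderiv ℝ η x (EuclideanSpace.single i 1)) :
    IsMultiplier Ωx t₀ T (expWeight χ ε)
      fun j y => -(expWeight χ ε y * convectionForm α β ε y {j}) := by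
  intro K hK hKΩ
  obtain ⟨M₁, hM₁⟩ := hbdd
  obtain ⟨M₂, hM₂⟩ := hχb
  let M := max 0 (max M₁ M₂)
  have hM0 : 0 ≤ M := le_max_left _ _
  have hpM : ∀ i : Fin 3, ∀ x ∈ Ωx, |(α x)⁻¹ * β x i| ≤ M := fun i x hx =>
    ((PiLp.norm_apply_le ((α x)⁻¹ • β x) i).trans (hM₁ x hx)).trans
      ((le_max_left _ _).trans (le_max_right _ _))
  have hpm : ∀ i : Fin 3, AEStronglyMeasurable (fun x => (α x)⁻¹ * β x i)
      (volume.restrict Ωx) := fun i =>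
    (hαm.inv.mul ((EuclideanSpace.proj (𝕜 := ℝ) i : Space →L[ℝ] ℝ).measurable.comp_aemeasurable
      hβm)).aestronglyMeasurable
  -- Only χ needs mollifying, and only in space; the exponent is already smooth in t.
  obtain ⟨F, hFs, hFM, hF1, hF2, hF3⟩ := exists_smooth_approx hΩo (hK.image continuous_fst)
    (by rintro _ ⟨y, hy, rfl⟩; exact (hKΩ hy).1) (f := χ)
    (p := fun (i : Fin 3) x => (α x)⁻¹ * β x i) (fun i => EuclideanSpace.single i 1) hχm hpm hM0
    (fun x hx => (hM₂ x hx).trans ((le_max_right _ _).trans (le_max_right _ _))) hpM hχ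
  have hFd : ∀ n, Differentiable ℝ (F n) := fun n => (hFs n).differentiable (by simp)
  obtain ⟨R, hR⟩ := (hK.image continuous_snd).bddAbove
  have hW : ∀ n, ∀ y ∈ K, expWeight (F n) ε y ≤ Real.exp (M + R / ε) := fun n y hy =>
    expWeight_le hε (hFM n y.1) (hR ⟨y, hy, rfl⟩)
  have hlim : ∀ y : Point, Tendsto (fun n => F n y.1) atTop (𝓝 (χ y.1)) →
      Tendsto (fun n => expWeight (F n) ε y) atTop (𝓝 (expWeight χ ε y)) := fun y hy =>
    (Real.continuous_exp.tendsto _).comp (hy.neg.add_const _)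
  have hE := Real.exp_pos (M + R / ε)
  -- The exponential bounds the weights on K. The factor 1 + M + ε⁻¹ dominates 1 for the values, M
  -- for the spatial derivatives of the exponent and ε⁻¹ for the time derivative.
  refine ⟨fun n => expWeight (F n) ε, Real.exp (M + R / ε) * (1 + M + ε⁻¹), fun n => ?_,
    fun n y hy => ?_, fun n j y hy => ?_, ?_, fun j => ?_, ?_⟩
  · have := hFs n
    unfold expWeight
    fun_prop
  · rw [abs_expWeight]
    refine (hW n y hy).trans (le_mul_of_one_le_right hE.le ?_)
    have := inv_pos.2 hε
    linarith
  · have hε' := inv_pos.2 hε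
    refine Fin.lastCases ?_ (fun i => ?_) j
    · rw [show Fin.last 3 = (3 : Fin 4) from rfl, fderiv_expWeight_three (hFd n), abs_mul,
        abs_expWeight, abs_of_pos hε']
      exact mul_le_mul (hW n y hy) (by linarith) hε'.le hE.le
    · rw [fderiv_expWeight_castSucc (hFd n), abs_neg, abs_mul, abs_expWeight]
      exact mul_le_mul (hW n y hy) ((hF2 n _ ⟨y, hy, rfl⟩ i).trans (by linarith))
        (abs_nonneg _) hE.le
  · exact (ae_Omega_of_ae hF1).mono fun y hy => hlim y hy
  · refine Fin.lastCases ?_ (fun i => ?_) j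
    · filter_upwards [ae_Omega_of_ae (t₀ := t₀) (T := T) hF1] with y h1 _
      rw [show Fin.last 3 = (3 : Fin 4) from rfl, convectionForm_three]
      simp only [fderiv_expWeight_three (hFd _), mul_neg, neg_neg]
      exact (hlim y h1).mul_const _
    · filter_upwards [ae_Omega_of_ae (t₀ := t₀) (T := T) hF1,
        ae_Omega_of_ae (t₀ := t₀) (T := T) (hF3 i)] with y h1 h2 hy
      simp only [convectionForm_castSucc, fderiv_expWeight_castSucc (hFd _)]
      exact ((hlim y h1).mul (h2 ⟨y, hy, rfl⟩)).neg
  -- The exceptional null set lies in space alone, so convergence holds on the slice t = T as well;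
  -- a potential known only almost everywhere in space-time would not give this.
  · filter_upwards [hF1] with x hx
    exact hlim (x, T) hx

end SpaceTime

/-! ### The bilinear form as a bounded form on triples. -/

namespace SpaceTime

open Filter
open scoped Topology

/-- Essentially bounded measurable functions. -/
def IsBddMeas {X : Type*} [MeasurableSpace X] (μ : Measure X) (a : X → ℝ) : Prop :=
  AEStronglyMeasurable a μ ∧ ∃ C : ℝ, ∀ᵐ x ∂μ, |a x| ≤ C

section IsBddMeas

variable {X : Type*} [MeasurableSpace X] {μ : Measure X} {a b : X → ℝ}

theorem IsBddMeas.exists_isMulOp {E : Type*} [NormedAddCommGroup E] [InnerProductSpace ℝ E]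
    (ha : IsBddMeas μ a) : ∃ A : Lp E 2 μ →L[ℝ] Lp E 2 μ, IsMulOp a A :=
  let ⟨_, hC⟩ := ha.2
  exists_mulLp E ha.1 hC

theorem IsBddMeas.mul (ha : IsBddMeas μ a) (hb : IsBddMeas μ b) :
    IsBddMeas μ fun x => a x * b x := by
  obtain ⟨C, hC⟩ := ha.2
  obtain ⟨D, hD⟩ := hb.2
  refine ⟨ha.1.mul hb.1, C * D, ?_⟩
  filter_upwards [hC, hD] with x h1 h2
  rw [abs_mul]
  exact mul_le_mul h1 h2 (abs_nonneg _) ((abs_nonneg _).trans h1)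

theorem IsBddMeas.neg (ha : IsBddMeas μ a) : IsBddMeas μ fun x => - a x :=
  ⟨ha.1.neg, by simpa using ha.2⟩

end IsBddMeas

variable {Ωx : Set Space} {t₀ T : ℝ}

theorem IsBddMeas.comp_fst {a : Space → ℝ} (ha : IsBddMeas (volume.restrict Ωx) a) :
    IsBddMeas ((volume : Measure Point).restrict (Omega Ωx t₀ T)) fun y => a y.1 := by
  obtain ⟨C, hC⟩ := ha.2
  refine ⟨?_, C, ae_Omega_of_ae hC⟩
  rw [volume_restrict_Omega]
  exact ha.1.comp_fst

theorem isBddMeas_of_forall {a : Space → ℝ} (hΩo : IsOpen Ωx)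
    (ha : AEStronglyMeasurable a (volume.restrict Ωx)) {C : ℝ} (hC : ∀ x ∈ Ωx, |a x| ≤ C) :
    IsBddMeas (volume.restrict Ωx) a :=
  ⟨ha, C, (ae_restrict_iff' hΩo.measurableSet).2 (Eventually.of_forall hC)⟩

theorem isBddMeas_convectionForm {α : Space → ℝ} {β : Space → Space} {ε : ℝ} (hΩo : IsOpen Ωx)
    (hαm : AEMeasurable α (volume.restrict Ωx)) (hβm : AEMeasurable β (volume.restrict Ωx))
    (hbdd : ∃ M : ℝ, ∀ x ∈ Ωx, ‖(α x)⁻¹ • β x‖ ≤ M) (j : Fin 4) :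
    IsBddMeas ((volume : Measure Point).restrict (Omega Ωx t₀ T))
      fun y => convectionForm α β ε y {j} := by
  obtain ⟨M, hM⟩ := hbdd
  refine Fin.lastCases ?_ (fun i => ?_) j
  · rw [show Fin.last 3 = (3 : Fin 4) from rfl]
    simp only [convectionForm_three]
    exact ⟨aestronglyMeasurable_const, _, Eventually.of_forall fun _ => le_rfl⟩
  · simp only [convectionForm_castSucc]
    refine IsBddMeas.comp_fst (a := fun x => (α x)⁻¹ * β x i) ?_
    refine isBddMeas_of_forall hΩo ?_ fun x hx =>
      (PiLp.norm_apply_le ((α x)⁻¹ • β x) i).trans (hM x hx)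
    exact (hαm.inv.mul ((EuclideanSpace.proj (𝕜 := ℝ) i : Space →L[ℝ] ℝ).measurable.comp_aemeasurable
      hβm)).aestronglyMeasurable

theorem isBddMeas_expWeight {ε : ℝ} (hε : 0 < ε) {χ : Space → ℝ} (hΩo : IsOpen Ωx)
    (hχ : IsBddMeas (volume.restrict Ωx) χ) :
    IsBddMeas ((volume : Measure Point).restrict (Omega Ωx t₀ T)) (expWeight χ ε) := by
  have h1 := hχ.comp_fst (t₀ := t₀) (T := T)
  obtain ⟨C, hC⟩ := h1.2
  refine ⟨Real.continuous_exp.comp_aestronglyMeasurable (h1.1.neg.add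
    (by fun_prop : Continuous fun y : Point => y.2 / ε).aestronglyMeasurable),
    Real.exp (C + T / ε), ?_⟩
  filter_upwards [hC, self_mem_ae_restrict (isOpen_Omega hΩo).measurableSet] with y h2 h3
  rw [abs_expWeight]
  exact expWeight_le hε h2 h3.2.2.le

theorem isBddMeas_expWeight_slice {ε : ℝ} (hε : 0 < ε) {χ : Space → ℝ}
    (hχ : IsBddMeas (volume.restrict Ωx) χ) :
    IsBddMeas (volume.restrict Ωx) fun x => expWeight χ ε (x, T) := by
  obtain ⟨C, hC⟩ := hχ.2
  refine ⟨Real.continuous_exp.comp_aestronglyMeasurable (hχ.1.neg.add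
    (aestronglyMeasurable_const (b := T / ε))), Real.exp (C + T / ε), ?_⟩
  filter_upwards [hC] with x h2
  rw [abs_expWeight]
  exact expWeight_le hε h2 le_rfl

/-- The flux of a triple. -/
def tripleFlux (α : Space → ℝ) (β : Space → Space) (ε : ℝ) (h : Triple Ωx t₀ T) (y : Point) :
    Form :=
  dPart h y + wedge (convectionForm α β ε y) (vPart h y)

/-- The integrand of the bilinear form. -/
def fluxPairing (α : Space → ℝ) (β : Space → Space) (ε : ℝ) (h h' : Triple Ωx t₀ T) (y : Point) :
    ℝ :=
  inner ℝ (hodgeStar (hodgeStarScaled (α y.1) ε (tripleFlux α β ε h y))) (dPart h' y)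

theorem coeFn_add_sum_extL2 {c : Fin 4 → Point → ℝ}
    {B : Fin 4 → L2Form Ωx t₀ T →L[ℝ] L2Form Ωx t₀ T} (hB : ∀ j, IsMulOp (c j) (B j))
    (w v : L2Form Ωx t₀ T) :
    ∀ᵐ y ∂((volume : Measure Point).restrict (Omega Ωx t₀ T)),
      (w + ∑ j, B j (extL2 Ωx t₀ T j v) : L2Form Ωx t₀ T) y =
        w y + ∑ j, c j y • extMul j (v y) := by
  have h1 : ∀ j, ∀ᵐ y ∂((volume : Measure Point).restrict (Omega Ωx t₀ T)),
      B j (extL2 Ωx t₀ T j v) y = c j y • extMul j (v y) := by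
    intro j
    filter_upwards [hB j (extL2 Ωx t₀ T j v), (extMul j).coeFn_compLpL (p := 2) v] with y h2 h3
    rw [h2, ← h3]
    rfl
  filter_upwards [ae_all_iff.2 h1, Lp.coeFn_add w (∑ j, B j (extL2 Ωx t₀ T j v)),
    Lp.coeFn_finsetSum Finset.univ fun j => B j (extL2 Ωx t₀ T j v)] with y h2 h3 h4
  rw [h3, Pi.add_apply, h4]
  simp [h2]

/-- The flux pairing as an inner product in `L²`. -/
theorem exists_fluxOperator {α : Space → ℝ} {β : Space → Space} {ε : ℝ} (hΩo : IsOpen Ωx)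
    (hα : IsBddMeas (volume.restrict Ωx) α)
    (hβm : AEMeasurable β (volume.restrict Ωx))
    (hbdd : ∃ M : ℝ, ∀ x ∈ Ωx, ‖(α x)⁻¹ • β x‖ ≤ M) :
    ∃ S : Triple Ωx t₀ T →L[ℝ] L2Form Ωx t₀ T, ∀ h,
      S h =ᵐ[(volume : Measure Point).restrict (Omega Ωx t₀ T)]
        fun y => hodgeStar (hodgeStarScaled (α y.1) ε (tripleFlux α β ε h y)) := by
  obtain ⟨A, hA⟩ := (hα.comp_fst (t₀ := t₀) (T := T)).exists_isMulOp (E := Form)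
  choose B hB using fun j => (isBddMeas_convectionForm (t₀ := t₀) (T := T) (ε := ε) hΩo
    hα.1.aemeasurable hβm hbdd j).exists_isMulOp (E := Form)
  let J : Triple Ωx t₀ T →L[ℝ] L2Form Ωx t₀ T :=
    dPart + ∑ j, (B j).comp ((extL2 Ωx t₀ T j).comp vPart)
  have hJ : ∀ h, J h = dPart h + ∑ j, B j (extL2 Ωx t₀ T j (vPart h)) := fun h => by simp [J]
  -- Variable and constant weights are separated: α multiplies the part without dt, ε the part with
  -- dt.
  let P := (hodgeScaledL 1 0).compLpL 2 ((volume : Measure Point).restrict (Omega Ωx t₀ T))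
  let Q := (hodgeScaledL 0 1).compLpL 2 ((volume : Measure Point).restrict (Omega Ωx t₀ T))
  refine ⟨A.comp (P.comp J) + ε • Q.comp J, fun h => ?_⟩
  have e : (A.comp (P.comp J) + ε • Q.comp J) h = A (P (J h)) + ε • Q (J h) := rfl
  rw [e]
  filter_upwards [coeFn_add_sum_extL2 hB (dPart h) (vPart h), hA (P (J h)),
    (hodgeScaledL 1 0).coeFn_compLpL (J h), (hodgeScaledL 0 1).coeFn_compLpL (J h),
    Lp.coeFn_add (A (P (J h))) (ε • Q (J h)), Lp.coeFn_smul ε (Q (J h))] with y h1 h2 h3 h4 h5 h6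
  rw [← hJ] at h1
  have h7 : J h y = tripleFlux α β ε h y := by
    rw [h1, tripleFlux, wedge_convectionForm]
  rw [h5, Pi.add_apply, h6, Pi.smul_apply, h2, hodgeStar_hodgeStarScaled, ← h7]
  exact congrArg₂ (fun p q => α y.1 • p + ε • q) h3 h4

theorem exists_bilin_eq_inner {H F : Type*} [NormedAddCommGroup H] [NormedSpace ℝ H]
    [NormedAddCommGroup F] [InnerProductSpace ℝ F] (S P : H →L[ℝ] F) :
    ∃ B : H →L[ℝ] H →L[ℝ] ℝ, ∀ h h', B h h' = inner ℝ (S h) (P h') := by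
  refine ⟨(LinearMap.mk₂ ℝ (fun h h' => inner ℝ (S h) (P h'))
    (fun _ _ _ => by rw [map_add, inner_add_left])
    (fun _ _ _ => by rw [map_smul, real_inner_smul_left, smul_eq_mul])
    (fun _ _ _ => by rw [map_add, inner_add_right])
    (fun _ _ _ => by rw [map_smul, real_inner_smul_right, smul_eq_mul])).mkContinuous₂
    (‖S‖ * ‖P‖) fun h h' => ?_, fun _ _ => rfl⟩
  calc ‖inner ℝ (S h) (P h')‖ ≤ ‖S h‖ * ‖P h'‖ := norm_inner_le_norm _ _
    _ ≤ (‖S‖ * ‖h‖) * (‖P‖ * ‖h'‖) :=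
      mul_le_mul (S.le_opNorm h) (P.le_opNorm h') (norm_nonneg _) (by positivity)
    _ = ‖S‖ * ‖P‖ * ‖h‖ * ‖h'‖ := by ring

theorem exists_bilin_eq_inner_add_inner {H F F' : Type*} [NormedAddCommGroup H] [NormedSpace ℝ H]
    [NormedAddCommGroup F] [InnerProductSpace ℝ F] [NormedAddCommGroup F'] [InnerProductSpace ℝ F']
    (s : ℝ) (S P : H →L[ℝ] F) (L : H →L[ℝ] F') :
    ∃ B : H →L[ℝ] H →L[ℝ] ℝ, ∀ h h',
      B h h' = s * inner ℝ (S h) (P h') + inner ℝ (L h) (L h') := by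
  obtain ⟨B₁, hB₁⟩ := exists_bilin_eq_inner S P
  obtain ⟨B₂, hB₂⟩ := exists_bilin_eq_inner L L
  exact ⟨s • B₁ + B₂, fun h h' => by simp [hB₁, hB₂]⟩

/-- The extension of the bilinear form to triples. -/
theorem exists_bilinear {α : Space → ℝ} {β : Space → Space} {ε : ℝ} (hΩo : IsOpen Ωx)
    (hα : IsBddMeas (volume.restrict Ωx) α)
    (hβm : AEMeasurable β (volume.restrict Ωx))
    (hbdd : ∃ M : ℝ, ∀ x ∈ Ωx, ‖(α x)⁻¹ • β x‖ ≤ M) (s : ℝ) :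
    ∃ B : Triple Ωx t₀ T →L[ℝ] Triple Ωx t₀ T →L[ℝ] ℝ, ∀ h h',
      Integrable (fluxPairing α β ε h h') (volume.restrict (Omega Ωx t₀ T)) ∧
      B h h' = s * (∫ y in Omega Ωx t₀ T, fluxPairing α β ε h h' y)
        + inner ℝ (gPart h) (gPart h') := by
  obtain ⟨S, hS⟩ := exists_fluxOperator (t₀ := t₀) (T := T) (ε := ε) hΩo hα hβm hbdd
  obtain ⟨B, hB⟩ := exists_bilin_eq_inner_add_inner s S dPart gPart
  refine ⟨B, fun h h' => ?_⟩
  have e : (fun y => inner ℝ (S h y) (dPart h' y)) =ᵐ[volume.restrict (Omega Ωx t₀ T)]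
      fluxPairing α β ε h h' := by
    filter_upwards [hS h] with y hy
    rw [hy, fluxPairing]
  have e2 : ∫ y in Omega Ωx t₀ T, fluxPairing α β ε h h' y = inner ℝ (S h) (dPart h') := by
    rw [L2.inner_def]
    exact (integral_congr_ae e).symm
  refine ⟨(L2.integrable_inner (𝕜 := ℝ) (S h) (dPart h')).congr e, ?_⟩
  rw [e2]
  exact hB h h'

theorem bilin_vPart {α : Space → ℝ} {β : Space → Space} {ε : ℝ} (hΩo : IsOpen Ωx) (hT : t₀ < T)
    {k : ℕ} {spatial : Prop} {h h' : Triple Ωx t₀ T} (hh : IsGraphTriple k spatial h)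
    (hh' : IsGraphTriple k spatial h') :
    bilin α β ε k (vPart h) (vPart h') =
      (-1 : ℝ) ^ (((k : ℤ) + 1) * (4 - ((k : ℤ) + 1))) *
        (∫ y in Omega Ωx t₀ T, fluxPairing α β ε h h' y) + inner ℝ (gPart h) (gPart h') := by
  simp only [bilin, flux, hh.weakD_eq hΩo, hh'.weakD_eq hΩo, hh.terminalTrace_eq hΩo hT,
    hh'.terminalTrace_eq hΩo hT, fluxPairing, tripleFlux]

/-- The exponential weight turns the flux into the exterior derivative. -/
theorem tripleFlux_mul {α : Space → ℝ} {β : Space → Space} {ε : ℝ} {m : Point → ℝ}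
    {A : L2Form Ωx t₀ T →L[ℝ] L2Form Ωx t₀ T} {B : Fin 4 → L2Form Ωx t₀ T →L[ℝ] L2Form Ωx t₀ T}
    (hA : IsMulOp m A) (hB : ∀ j, IsMulOp (fun y => -(m y * convectionForm α β ε y {j})) (B j))
    (w v : L2Form Ωx t₀ T) (g : L2Terminal Ωx) :
    ∀ᵐ y ∂((volume : Measure Point).restrict (Omega Ωx t₀ T)),
      tripleFlux α β ε (mkTriple (A w + ∑ j, B j (extL2 Ωx t₀ T j v)) (A v) g) y = m y • w y := by
  filter_upwards [hA w, hA v, coeFn_add_sum_extL2 hB (A w) v] with y h1 h2 h3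
  rw [tripleFlux, dPart_mkTriple, vPart_mkTriple, h3, h1, h2, wedge_convectionForm]
  -- The gradient term -m b₁ ∧ v cancels b₁ ∧ (m v).
  simp [smul_smul, mul_comm]

theorem _root_.IsMulOp.eq_zero_of_inner {X : Type*} [MeasurableSpace X] {μ : Measure X} {a : X → ℝ}
    {A : Lp Form 2 μ →L[ℝ] Lp Form 2 μ} (hA : IsMulOp a A) (ha : ∀ x, 0 < a x) {g : Lp Form 2 μ}
    (h : inner ℝ (A g) g ≤ 0) : g = 0 := by
  have hi := L2.integrable_inner (𝕜 := ℝ) (A g) g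
  have hpt : ∀ᵐ x ∂μ, inner ℝ (A g x) (g x) = a x * ‖g x‖ ^ 2 := by
    filter_upwards [hA g] with x hx
    rw [hx, real_inner_smul_left, real_inner_self_eq_norm_sq]
  have hnn : 0 ≤ᵐ[μ] fun x => inner ℝ (A g x) (g x) := by
    filter_upwards [hpt] with x hx
    rw [hx]
    exact mul_nonneg (ha x).le (sq_nonneg _)
  rw [L2.inner_def] at h
  have h0 := (integral_eq_zero_iff_of_nonneg_ae hnn hi).1
    (le_antisymm h (integral_nonneg_of_ae hnn))
  rw [Lp.eq_zero_iff_ae_eq_zero]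
  filter_upwards [h0, hpt] with x h1 h2
  rw [h2] at h1
  simpa [(ha x).ne'] using h1

theorem _root_.IsMulOp.inner_nonneg {X : Type*} [MeasurableSpace X] {μ : Measure X} {a : X → ℝ}
    {A : Lp Form 2 μ →L[ℝ] Lp Form 2 μ} (hA : IsMulOp a A) (ha : ∀ x, 0 < a x) (g : Lp Form 2 μ) :
    0 ≤ inner ℝ (A g) g := by
  rw [L2.inner_def]
  refine integral_nonneg_of_ae ?_
  filter_upwards [hA g] with x hx
  rw [hx, real_inner_smul_left, real_inner_self_eq_norm_sq]
  exact mul_nonneg (ha x).le (sq_nonneg _)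

/-! ### Nondegeneracy in the second argument. -/

/-- The weighted energy controls the derivative and the terminal trace. -/
theorem eq_zero_of_energy {α : Space → ℝ} {β : Space → Space} {ε : ℝ} (hε : 0 < ε)
    (hΩo : IsOpen Ωx) (hα : ∀ x ∈ Ωx, 0 < α x) {k : ℕ} (hk : k ≤ 4)
    {m : Point → ℝ} (hm : ∀ y, 0 < m y) {h u : Triple Ωx t₀ T}
    (hdeg : dPart h ∈ L2Lambda Ωx t₀ T (k + 1))
    (hu : ∀ᵐ y ∂((volume : Measure Point).restrict (Omega Ωx t₀ T)),
      tripleFlux α β ε u y = m y • dPart h y)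
    {AT : L2Terminal Ωx →L[ℝ] L2Terminal Ωx} (hAT : IsMulOp (fun x => m (x, T)) AT)
    (hug : gPart u = AT (gPart h))
    (hi : Integrable (fluxPairing α β ε u h) (volume.restrict (Omega Ωx t₀ T)))
    (h0 : (-1 : ℝ) ^ (((k : ℤ) + 1) * (4 - ((k : ℤ) + 1))) *
        (∫ y in Omega Ωx t₀ T, fluxPairing α β ε u h y) + inner ℝ (gPart u) (gPart h) = 0) :
    dPart h = 0 ∧ gPart h = 0 := by
  set s : ℝ := (-1 : ℝ) ^ (((k : ℤ) + 1) * (4 - ((k : ℤ) + 1))) with hs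
  have hpt : ∀ᵐ y ∂((volume : Measure Point).restrict (Omega Ωx t₀ T)),
      m y * (min (α y.1) ε * ‖dPart h y‖ ^ 2) ≤ s * fluxPairing α β ε u h y := by
    have hdeg' : ∀ᵐ y ∂((volume : Measure Point).restrict (Omega Ωx t₀ T)),
      ∀ I : Finset (Fin 4), I.card ≠ k + 1 → dPart h y I = 0 := hdeg
    filter_upwards [hu, hdeg'] with y h1 h2
    have h3 := inner_hodgeStar_hodgeStarScaled (α y.1) ε k hk (dPart h y) h2
    have h4 : fluxPairing α β ε u h y =
        m y * inner ℝ (hodgeStar (hodgeStarScaled (α y.1) ε (dPart h y))) (dPart h y) := by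
      rw [fluxPairing, h1, ← hodgeScaledL_apply, map_smul, real_inner_smul_left,
        hodgeScaledL_apply]
    rw [h4, mul_left_comm s]
    exact mul_le_mul_of_nonneg_left h3 (hm y).le
  have hmin : ∀ᵐ y ∂((volume : Measure Point).restrict (Omega Ωx t₀ T)), 0 < min (α y.1) ε := by
    filter_upwards [self_mem_ae_restrict (isOpen_Omega hΩo).measurableSet] with y hy
    exact lt_min (hα _ hy.1) hε
  have hnn : 0 ≤ᵐ[volume.restrict (Omega Ωx t₀ T)] fun y => s * fluxPairing α β ε u h y := by
    filter_upwards [hpt, hmin] with y h1 h2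
    exact le_trans (mul_nonneg (hm y).le (mul_nonneg h2.le (sq_nonneg _))) h1
  -- Two nonnegative terms sum to zero in `h0`, so each vanishes.
  rw [hug, ← integral_const_mul] at h0
  have hg0 := hAT.inner_nonneg (fun x => hm (x, T)) (gPart h)
  have hI0 := integral_nonneg_of_ae hnn
  refine ⟨?_, hAT.eq_zero_of_inner (fun x => hm (x, T)) (by linarith)⟩
  have h5 := (integral_eq_zero_iff_of_nonneg_ae hnn (hi.const_mul s)).1 (by linarith)
  rw [Lp.eq_zero_iff_ae_eq_zero]
  filter_upwards [hpt, hmin, h5] with y h1 h2 h3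
  simp only [h3, Pi.zero_apply] at h1 ⊢
  by_contra h4
  have : 0 < ‖dPart h y‖ := norm_pos_iff.2 h4
  have := mul_pos (hm y) (mul_pos h2 (pow_pos this 2))
  linarith

/-- If the form pairs a triple to zero with every triple, then the triple vanishes, provided that the
form is nondegenerate in the first argument. -/
theorem eq_zero_of_forall_bilin_eq_zero {α : Space → ℝ} {β : Space → Space} {ε : ℝ} (hε : 0 < ε)
    (hΩo : IsOpen Ωx) (hα : ∀ x ∈ Ωx, 0 < α x) {k : ℕ} (hk : k ≤ 4) {spatial : Prop}
    {χ : Space → ℝ} (hχ : IsBddMeas (volume.restrict Ωx) χ)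
    (hc : ∀ j, IsBddMeas ((volume : Measure Point).restrict (Omega Ωx t₀ T))
      fun y => convectionForm α β ε y {j})
    (hm : IsMultiplier Ωx t₀ T (expWeight χ ε)
      fun j y => -(expWeight χ ε y * convectionForm α β ε y {j}))
    {B : Triple Ωx t₀ T →L[ℝ] Triple Ωx t₀ T →L[ℝ] ℝ} (hB : ∀ h h',
      Integrable (fluxPairing α β ε h h') (volume.restrict (Omega Ωx t₀ T)) ∧
      B h h' = (-1 : ℝ) ^ (((k : ℤ) + 1) * (4 - ((k : ℤ) + 1))) *
        (∫ y in Omega Ωx t₀ T, fluxPairing α β ε h h' y) + inner ℝ (gPart h) (gPart h'))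
    (hB1 : ∀ u, IsGraphTriple k spatial u → (∀ h, IsGraphTriple k spatial h → B u h = 0) → u = 0)
    {h : Triple Ωx t₀ T} (hh : IsGraphTriple k spatial h)
    (h0 : ∀ u, IsGraphTriple k spatial u → B u h = 0) : vPart h = 0 := by
  have hmΩ := isBddMeas_expWeight (t₀ := t₀) (T := T) hε hΩo hχ
  obtain ⟨A, hA⟩ := hmΩ.exists_isMulOp (E := Form)
  choose D hD using fun j => (hmΩ.mul (hc j)).neg.exists_isMulOp (E := Form)
  obtain ⟨AT, hAT⟩ := (isBddMeas_expWeight_slice (T := T) hε hχ).exists_isMulOp (E := Form)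
  have hpos : ∀ y, 0 < expWeight χ ε y := fun y => Real.exp_pos _
  have hu := hm.isGraphTriple hA hD hAT hh
  have hflux := tripleFlux_mul hA hD (dPart h) (vPart h) (AT (gPart h))
  set u := mkTriple (A (dPart h) + ∑ j, D j (extL2 Ωx t₀ T j (vPart h)))
      (A (vPart h)) (AT (gPart h)) with hu_def
  -- The decisive choice: the given triple is tested with its own multiple by the weight.
  have e0 := h0 u hu
  rw [(hB u h).2] at e0
  obtain ⟨hd, hg⟩ := eq_zero_of_energy hε hΩo hα hk hpos hh.degD hflux hAT rfl (hB u h).1 e0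
  -- With dv and tr v gone, m v has zero flux and zero trace, so it is in the left kernel, which
  -- `hB1` says is trivial.
  have hu0 : u = 0 := by
    refine hB1 u hu fun h' _ => ?_
    rw [(hB u h').2]
    have hgu : gPart u = 0 := by
      rw [hu_def, gPart_mkTriple, hg, map_zero]
    have hz : ∫ y in Omega Ωx t₀ T, fluxPairing α β ε u h' y = 0 := by
      refine integral_eq_zero_of_ae ?_
      rw [Lp.eq_zero_iff_ae_eq_zero] at hd
      filter_upwards [hflux, hd] with y h1 h2
      rw [fluxPairing, h1, h2, Pi.zero_apply, smul_zero, ← hodgeScaledL_apply, map_zero,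
        inner_zero_left, Pi.zero_apply]
    rw [hz, hgu, inner_zero_left, mul_zero, add_zero]
  have hv0 : A (vPart h) = 0 := by
    have : vPart u = 0 := by rw [hu0, map_zero]
    exact this
  exact hA.eq_zero_of_inner hpos (by rw [hv0, inner_zero_left])

/-! ### From the inf-sup condition to well-posedness. -/

/-- The inf-sup condition in terms of the operator norm. -/
theorem exists_le_norm_of_infSup {α : Space → ℝ} {β : Space → Space} {ε : ℝ} (hΩo : IsOpen Ωx)
    (hT : t₀ < T) {k : ℕ} {spatial : Prop}
    (hinf : InfSup (HLambdaDSet Ωx t₀ T k spatial) (bilin α β ε k)) :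
    ∃ c > 0, ∀ u : Triple Ωx t₀ T, IsGraphTriple k spatial u → vPart u ≠ 0 →
      ∃ h : Triple Ωx t₀ T, IsGraphTriple k spatial h ∧ 0 < ‖h‖ ∧
        c * ‖u‖ * ‖h‖ ≤ bilin α β ε k (vPart u) (vPart h) := by
  obtain ⟨c, hc, hle⟩ := hinf
  -- The supremum need not be attained; giving up half of the constant yields an actual test form.
  refine ⟨c / 2, half_pos hc, fun u hu hu0 => ?_⟩
  have h1 := hle.trans (iInf₂_le (vPart u) ⟨hu.mem hΩo, hu0⟩)
  have h2 : ((c / 2 : ℝ) : EReal) < c := EReal.coe_lt_coe_iff.2 (half_lt_self hc)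
  obtain ⟨v, hv⟩ := lt_iSup_iff.1 (h2.trans_le h1)
  obtain ⟨⟨hvV, hv0⟩, hv⟩ := lt_iSup_iff.1 hv
  obtain ⟨h, hh, rfl⟩ := exists_isGraphTriple hΩo k spatial hvV
  have hpos : ∀ w : Triple Ωx t₀ T, vPart w ≠ 0 → 0 < ‖w‖ := fun w hw =>
    norm_pos_iff.2 fun hw0 => hw (by rw [hw0, map_zero])
  have hh0 := hpos h hv0
  refine ⟨h, hh, hh0, ?_⟩
  rw [hu.normHD_eq hΩo hT, hh.normHD_eq hΩo hT, EReal.coe_lt_coe_iff,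
    lt_div_iff₀ (mul_pos (hpos u hu0) hh0)] at hv
  rw [mul_assoc]
  exact hv.le

theorem norm_vPart_le (h : Triple Ωx t₀ T) : ‖vPart h‖ ≤ ‖h‖ := by
  refine le_of_sq_le_sq ?_ (norm_nonneg _)
  rw [Triple.norm_sq]
  nlinarith [sq_nonneg ‖dPart h‖, sq_nonneg ‖gPart h‖]

/-- The Banach–Nečas–Babuška theorem on a closed subspace of a Hilbert space. -/
theorem exists_unique_of_infSup {H F : Type*} [NormedAddCommGroup H] [InnerProductSpace ℝ H]
    [CompleteSpace H] [NormedAddCommGroup F] [InnerProductSpace ℝ F] {p : H → Prop}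
    (hp : IsClosedLinear p) (B : H →L[ℝ] H →L[ℝ] ℝ) (L : H →L[ℝ] F) (hL : ∀ h, ‖L h‖ ≤ ‖h‖)
    {c : ℝ} (hc : 0 < c)
    (h1 : ∀ u, p u → u ≠ 0 → ∃ h, p h ∧ 0 < ‖h‖ ∧ c * ‖u‖ * ‖h‖ ≤ B u h)
    (h2 : ∀ h, p h → (∀ u, p u → B u h = 0) → h = 0) (f : F) :
    ∃ u, p u ∧ (∀ h, p h → B u h = inner ℝ f (L h)) ∧
      (∀ u', p u' → (∀ h, p h → B u' h = inner ℝ f (L h)) → u' = u) ∧ ‖u‖ ≤ c⁻¹ * ‖f‖ := by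
  obtain ⟨G, hGc, hG⟩ := hp
  have : CompleteSpace G := hGc.completeSpace_coe
  let BG : G →L[ℝ] G →L[ℝ] ℝ := B.bilinearComp G.subtypeL G.subtypeL
  have hlow : ∀ u : G, c * ‖u‖ ≤ ‖BG u‖ := by
    intro u
    by_cases hu0 : (u : H) = 0
    · have : u = 0 := Subtype.ext hu0
      rw [this, norm_zero, mul_zero]
      exact norm_nonneg (BG 0)
    · obtain ⟨h, hh, hpos, hle⟩ := h1 u ((hG u).1 u.2) hu0
      have h3 := (le_abs_self _).trans ((BG u).le_opNorm ⟨h, (hG h).2 hh⟩)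
      exact le_of_mul_le_mul_right (hle.trans h3) hpos
  have hinj : ∀ u : G, BG u = 0 → u = 0 := by
    intro u hu
    have h3 : c * ‖u‖ ≤ 0 := (hlow u).trans_eq (by rw [hu]; exact ContinuousLinearMap.opNorm_zero)
    exact norm_le_zero_iff.1 (le_of_mul_le_mul_left (by rwa [mul_zero]) hc)
  obtain ⟨l, hl⟩ : ∃ l : G →L[ℝ] ℝ, ∀ h : G, l h = inner ℝ f (L h) :=
    ⟨(innerSL ℝ f).comp (L.comp G.subtypeL), fun _ => rfl⟩
  obtain ⟨u, hu⟩ := exists_eq_of_infSup BG hc hlow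
    (fun h hh => Subtype.ext (h2 h ((hG h).1 h.2) fun u hu => hh ⟨u, (hG u).2 hu⟩)) l
  refine ⟨u, (hG u).1 u.2, fun h hh => ?_, fun u' hu' hsol => ?_, ?_⟩
  · rw [← hl ⟨h, (hG h).2 hh⟩, ← hu]
    rfl
  · have h3 : BG (⟨u', (hG u').2 hu'⟩ - u) = 0 := by
      rw [map_sub, hu, sub_eq_zero]
      ext h
      rw [hl]
      exact hsol h ((hG h).1 h.2)
    exact congrArg Subtype.val (sub_eq_zero.1 (hinj _ h3))
  -- Stability: c ‖u‖ is at most the norm of the functional, which is at most ‖f‖ because `L` does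
  -- not increase norms.
  · rw [inv_mul_eq_div, le_div_iff₀ hc, mul_comm]
    refine (hlow u).trans ?_
    rw [hu]
    refine l.opNorm_le_bound (norm_nonneg _) fun h => ?_
    rw [hl]
    exact (norm_inner_le_norm f _).trans (mul_le_mul_of_nonneg_left (hL _) (norm_nonneg _))

/-- Well-posedness on `HΛ^k_D(Ω)` or its subspace without `dt`. -/
theorem exists_unique_solution {α : Space → ℝ} {β : Space → Space} {ε : ℝ} (hε : 0 < ε)
    (hΩo : IsOpen Ωx) (hT : t₀ < T) (hα : ∀ x ∈ Ωx, 0 < α x)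
    (hαb : IsBddMeas (volume.restrict Ωx) α) (hβm : AEMeasurable β (volume.restrict Ωx))
    (hbdd : ∃ M : ℝ, ∀ x ∈ Ωx, ‖(α x)⁻¹ • β x‖ ≤ M)
    (ψ₀ : Point → ℝ) (hψm : AEMeasurable ψ₀ (volume.restrict (Omega Ωx t₀ T)))
    (hψb : ∃ M : ℝ, ∀ y ∈ Omega Ωx t₀ T, |ψ₀ y| ≤ M)
    (hψ : IsWeakD (Omega Ωx t₀ T) (zeroForm ψ₀) (convectionForm α β ε))
    {k : ℕ} (hk : k ≤ 4) {spatial : Prop}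
    (hinf : InfSup (HLambdaDSet Ωx t₀ T k spatial) (bilin α β ε k)) :
    ∃ C > 0, ∀ f : L2Form Ωx t₀ T, ∃ u ∈ HLambdaDSet Ωx t₀ T k spatial,
      (∀ v ∈ HLambdaDSet Ωx t₀ T k spatial, bilin α β ε k u v = inner ℝ f v) ∧
      (∀ u' ∈ HLambdaDSet Ωx t₀ T k spatial,
        (∀ v ∈ HLambdaDSet Ωx t₀ T k spatial, bilin α β ε k u' v = inner ℝ f v) → u' = u) ∧
      normHD u ≤ C * ‖f‖ := by
  obtain ⟨χ, M, hχm, hχM, hχ⟩ := exists_spatial_potential hΩo hT ψ₀ hψm hψb hψ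
  have hm := isMultiplier_expWeight (t₀ := t₀) (T := T) hΩo hε hαb.1.aemeasurable hβm hbdd hχm
    ⟨M, hχM⟩ hχ
  have hc := isBddMeas_convectionForm (t₀ := t₀) (T := T) (ε := ε) hΩo hαb.1.aemeasurable hβm hbdd
  obtain ⟨B, hB⟩ := exists_bilinear (t₀ := t₀) (T := T) (ε := ε) hΩo hαb hβm hbdd
    ((-1 : ℝ) ^ (((k : ℤ) + 1) * (4 - ((k : ℤ) + 1))))
  have hbil : ∀ {h h' : Triple Ωx t₀ T}, IsGraphTriple k spatial h → IsGraphTriple k spatial h' →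
      bilin α β ε k (vPart h) (vPart h') = B h h' := fun hh hh' => by
    rw [bilin_vPart hΩo hT hh hh', (hB _ _).2]
  obtain ⟨c, hc0, hcB⟩ := exists_le_norm_of_infSup hΩo hT hinf
  have hcl := isClosedLinear_isGraphTriple (Ωx := Ωx) (t₀ := t₀) (T := T) k spatial
  have hGv : ∀ u : Triple Ωx t₀ T, IsGraphTriple k spatial u → vPart u = 0 → u = 0 := by
    intro u hu hu0
    obtain ⟨G, -, hG⟩ := hcl
    exact hu.ext hΩo hT ((hG 0).1 G.zero_mem) (by rw [hu0, map_zero])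
  have h1 : ∀ u : Triple Ωx t₀ T, IsGraphTriple k spatial u → u ≠ 0 →
      ∃ h, IsGraphTriple k spatial h ∧ 0 < ‖h‖ ∧ c * ‖u‖ * ‖h‖ ≤ B u h := by
    intro u hu hu0
    obtain ⟨h, hh, hpos, hle⟩ := hcB u hu fun h0 => hu0 (hGv u hu h0)
    exact ⟨h, hh, hpos, by rwa [hbil hu hh] at hle⟩
  have h2 : ∀ h : Triple Ωx t₀ T, IsGraphTriple k spatial h →
      (∀ u, IsGraphTriple k spatial u → B u h = 0) → h = 0 := by
    intro h hh hh0
    refine hGv h hh (eq_zero_of_forall_bilin_eq_zero hε hΩo hα hk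
      (isBddMeas_of_forall hΩo hχm hχM) hc hm hB ?_ hh hh0)
    -- A nonzero u in the left kernel would have a partner with strictly positive pairing.
    intro u hu hu0
    by_contra hne
    obtain ⟨h', hh', hpos, hle⟩ := h1 u hu hne
    rw [hu0 h' hh'] at hle
    exact absurd hle (not_le.2 (mul_pos (mul_pos hc0 (norm_pos_iff.2 hne)) hpos))
  refine ⟨c⁻¹, inv_pos.2 hc0, fun f => ?_⟩
  obtain ⟨u, hu, hsol, huniq, hnorm⟩ :=
    exists_unique_of_infSup hcl B vPart norm_vPart_le hc0 h1 h2 f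
  refine ⟨vPart u, hu.mem hΩo, ?_, ?_, ?_⟩
  · intro v hv
    obtain ⟨h, hh, rfl⟩ := exists_isGraphTriple hΩo k spatial hv
    rw [hbil hu hh, hsol h hh]
  · intro u' hu' hsol'
    obtain ⟨w, hw, rfl⟩ := exists_isGraphTriple hΩo k spatial hu'
    rw [huniq w hw fun h hh => by rw [← hbil hw hh, hsol' _ (hh.mem hΩo)]]
  · rwa [hu.normHD_eq hΩo hT]

theorem HLambdaDSet_false (k : ℕ) : HLambdaDSet Ωx t₀ T k False = HLambdaD Ωx t₀ T k := by
  ext v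
  simp [HLambdaDSet]

theorem HLambdaDSet_true (k : ℕ) : HLambdaDSet Ωx t₀ T k True = HLambdaDSpatial Ωx t₀ T k := by
  ext v
  simp [HLambdaDSet, HLambdaDSpatial]

end SpaceTime

end

theorem mainTheorem1
    (Ωx : Set Space) (hΩo : IsOpen Ωx) (hΩb : Bornology.IsBounded Ωx)
    (t₀ T : ℝ) (hT : t₀ < T)
    (α : Space → ℝ) (β : Space → Space) (ε : ℝ) (hε : 0 < ε)
    (hαm : AEMeasurable α (volume.restrict Ωx)) (hβm : AEMeasurable β (volume.restrict Ωx))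
    (hα : ∀ x ∈ Ωx, 0 < α x)
    (hbdd : ∃ M : ℝ, ∀ x ∈ Ωx, α x ≤ M ∧ ‖(α x)⁻¹ • β x‖ ≤ M)
    -- the bounded potential of the convection form: `d ψ₀ = b₁` on `Ω`
    (ψ₀ : Point → ℝ) (hψm : AEMeasurable ψ₀ (volume.restrict (Omega Ωx t₀ T)))
    (hψb : ∃ M : ℝ, ∀ y ∈ Omega Ωx t₀ T, |ψ₀ y| ≤ M)
    (hψ : IsWeakD (Omega Ωx t₀ T) (zeroForm ψ₀) (convectionForm α β ε))
    (k : ℕ) (hk : k ≤ 4)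
    (V : Set (L2Form Ωx t₀ T))
    (hV : V = HLambdaD Ωx t₀ T k ∨ V = HLambdaDSpatial Ωx t₀ T k)
    (hcont : ContinuousOnSpace V (bilin α β ε k))
    (hinfsup : InfSup V (bilin α β ε k)) :
    ∃ C > 0, ∀ f ∈ L2Lambda Ωx t₀ T k,
      ∃ u ∈ V, (∀ v ∈ V, bilin α β ε k u v = inner ℝ f v) ∧
        (∀ u' ∈ V, (∀ v ∈ V, bilin α β ε k u' v = inner ℝ f v) → u' = u) ∧
        normHD u ≤ C * ‖f‖ := by
  obtain ⟨M, hM⟩ := hbdd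
  have hαb : IsBddMeas (volume.restrict Ωx) α :=
    isBddMeas_of_forall hΩo hαm.aestronglyMeasurable fun x hx => by
      rw [abs_of_pos (hα x hx)]
      exact (hM x hx).1
  -- A propositional switch for the no-dt condition lets both choices of V share one argument.
  obtain ⟨spatial, hVs⟩ : ∃ spatial, V = HLambdaDSet Ωx t₀ T k spatial := by
    rcases hV with hV | hV
    · exact ⟨False, hV.trans (HLambdaDSet_false k).symm⟩
    · exact ⟨True, hV.trans (HLambdaDSet_true k).symm⟩
  subst hVs
  obtain ⟨C, hC, h⟩ := exists_unique_solution hε hΩo hT hα hαb hβm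
    ⟨M, fun x hx => (hM x hx).2⟩ ψ₀ hψm hψb hψ hk hinfsup
  exact ⟨C, hC, fun f _ => h f⟩
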